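/- For a permutation $\sigma$ of $[n]=\{1,\dots,n\}$, let $\mathrm{fp}(\sigma)$, $\mathrm{exc}(\sigma)$ and $\mathrm{inv}(\sigma)$ be the numbers of indices $i$ with $\sigma(i)=i$, of indices $i$ with $\sigma(i)>i$, and of pairs $i<j$ with $\sigma(i)>\sigma(j)$. Let $\mathrm{crs}(\sigma)$ be the number of crossings, i.e. pairs $(i,j)$ with $i<j<\sigma(i)<\sigma(j)$ or $\sigma(i)<\sigma(j)\le i<j$, and let $\mathrm{nes}(\sigma)$ be the number of nestings, i.e. pairs $(i,j)$ with $i<j<\sigma(j)<\sigma(i)$ or $\sigma(j)<\sigma(i)\le i<j$. For a pattern $\tau$, let $S_n(\tau)$ be the set of permutations of $[n]$ that have no subsequence with the same relative order as $\tau$. Two patterns $\tau,\tau'\in S_3$ are called $(\mathrm{st}_1,\dots,\mathrm{st}_k)$-Wilf equivalent if, for every $n$, $$\sum_{\sigma\in S_n(\tau)}x_1^{\mathrm{st}_1(\sigma)}\cdots x_k^{\mathrm{st}_k(\sigma)}=\sum_{\sigma\in S_n(\tau')}x_1^{\mathrm{st}_1(\sigma)}\cdots x_k^{\mathrm{st}_k(\sigma)},$$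 and $[\tau]_{\mathrm{st}_1,\dots,\mathrm{st}_k}\subseteq S_3$ denotes the equivalence class of $\tau$. **Theorem.** For patterns in $S_3$: (i) $[132]_{\mathrm{fp},\mathrm{exc},\mathrm{inv},\mathrm{crs},\mathrm{nes}}=\{132,213\}$, and this is the only $(\mathrm{fp},\mathrm{exc},\mathrm{inv},\mathrm{crs},\mathrm{nes})$-Wilf-equivalence class with more than one element; (ii) $[231]_{\mathrm{fp},\mathrm{inv},\mathrm{nes}}=\{231,312\}$, and the $(\mathrm{fp},\mathrm{inv},\mathrm{nes})$-Wilf-equivalence classes with more than one element are exactly $\{132,213\}$ and $\{231,312\}$; (iii) $[132]_{\mathrm{fp},\mathrm{exc},\mathrm{crs}}=\{132,213,321\}$, and this is the only $(\mathrm{fp},\mathrm{exc},\mathrm{crs})$-Wilf-equivalence class with more than one element. -/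

import Mathlib

namespace PermPattern

/-- A statistic on permutations: a natural number attached to every permutation of every length.
Permutations of length `n` are written on the index set `Fin n = {0, …, n - 1}`; all notions
below are invariant under the shift to `{1, …, n}`. -/
abbrev Stat : Type := ∀ n : ℕ, Equiv.Perm (Fin n) → ℕ

/-- Number of fixed points. -/
def fp : Stat := fun n σ =>
  (Finset.univ.filter fun i : Fin n => σ i = i).card

/-- Number of excedances: indices `i` with `σ i > i`. -/
def exc : Stat := fun n σ =>
  (Finset.univ.filter fun i : Fin n => i < σ i).card

/-- Number of inversions: pairs `(i, j)` with `i < j` and `σ i > σ j`. -/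
def inv : Stat := fun n σ =>
  (Finset.univ.filter fun p : Fin n × Fin n => p.1 < p.2 ∧ σ p.2 < σ p.1).card

/-- Number of crossings: pairs `(i, j)` with `i < j < σ i < σ j` or `σ i < σ j ≤ i < j`. -/
def crs : Stat := fun n σ =>
  (Finset.univ.filter fun p : Fin n × Fin n =>
    (p.1 < p.2 ∧ p.2 < σ p.1 ∧ σ p.1 < σ p.2) ∨
    (σ p.1 < σ p.2 ∧ σ p.2 ≤ p.1 ∧ p.1 < p.2)).card

/-- Number of nestings: pairs `(i, j)` with `i < j < σ j < σ i` or `σ j < σ i ≤ i < j`. -/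
def nes : Stat := fun n σ =>
  (Finset.univ.filter fun p : Fin n × Fin n =>
    (p.1 < p.2 ∧ p.2 < σ p.2 ∧ σ p.2 < σ p.1) ∨
    (σ p.2 < σ p.1 ∧ σ p.1 ≤ p.1 ∧ p.1 < p.2)).card

/-- `σ` contains the pattern `τ`: for some positions `f 0 < f 1 < ⋯ < f (k - 1)`, the
subsequence `σ (f 0), …, σ (f (k - 1))` has the same relative order as `τ`, that is, its
reduction is `τ`. -/
def Contains {k n : ℕ} (σ : Equiv.Perm (Fin n)) (τ : Equiv.Perm (Fin k)) : Prop :=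
  ∃ f : Fin k → Fin n, StrictMono f ∧ ∀ a b : Fin k, σ (f a) < σ (f b) ↔ τ a < τ b

open Classical in
/-- `S_n(T)`: the permutations of length `n` avoiding every pattern in the set `T`
(patterns of arbitrary lengths). -/
noncomputable def avoiders (T : Set (Σ k : ℕ, Equiv.Perm (Fin k))) (n : ℕ) :
    Finset (Equiv.Perm (Fin n)) :=
  Finset.univ.filter fun σ => ∀ τ ∈ T, ¬ Contains σ τ.2

/-- The joint generating polynomial `∑_{σ ∈ S_n(T)} ∏_i x_i ^ st_i(σ)` of a finite family of
statistics. -/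
noncomputable def genPoly {ι : Type*} [Fintype ι] (st : ι → Stat)
    (T : Set (Σ k : ℕ, Equiv.Perm (Fin k))) (n : ℕ) : MvPolynomial ι ℤ :=
  ∑ σ ∈ avoiders T n, ∏ i, MvPolynomial.X i ^ st i n σ

/-- Wilf equivalence of two sets of patterns with respect to a finite family of statistics:
the joint distributions agree on `S_n(T)` and `S_n(T')` for every `n`. -/
def WilfEquiv {ι : Type*} [Fintype ι] (st : ι → Stat)
    (T T' : Set (Σ k : ℕ, Equiv.Perm (Fin k))) : Prop :=
  ∀ n : ℕ, genPoly st T n = genPoly st T' n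

/-- The Wilf-equivalence class `[τ]_st` among single patterns of the same length `k`. -/
def wilfClass {ι : Type*} [Fintype ι] (st : ι → Stat) {k : ℕ} (τ : Equiv.Perm (Fin k)) :
    Set (Equiv.Perm (Fin k)) :=
  {τ' | WilfEquiv st {⟨k, τ⟩} {⟨k, τ'⟩}}

/-- The Wilf-equivalence classes of single patterns of length `k` that have at least two
elements. -/
def nonSingletonClasses {ι : Type*} [Fintype ι] (st : ι → Stat) (k : ℕ) :
    Set (Set (Equiv.Perm (Fin k))) :=
  {C | (∃ τ : Equiv.Perm (Fin k), C = wilfClass st τ) ∧ C.Nontrivial}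

/-- The permutation `132` (one-line notation, with values shifted down by one below). -/
def p132 : Equiv.Perm (Fin 3) := ⟨![0, 2, 1], ![0, 2, 1], by decide, by decide⟩

/-- The permutation `213`. -/
def p213 : Equiv.Perm (Fin 3) := ⟨![1, 0, 2], ![1, 0, 2], by decide, by decide⟩

/-- The permutation `231`. -/
def p231 : Equiv.Perm (Fin 3) := ⟨![1, 2, 0], ![2, 0, 1], by decide, by decide⟩

/-- The permutation `312`. -/
def p312 : Equiv.Perm (Fin 3) := ⟨![2, 0, 1], ![1, 2, 0], by decide, by decide⟩

/-- The permutation `321`. -/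
def p321 : Equiv.Perm (Fin 3) := ⟨![2, 1, 0], ![2, 1, 0], by decide, by decide⟩

end PermPattern

/-!
For `(fp, exc, crs)`, give each point of the graph of a permutation a weight recording its position
relative to the diagonal and the number of crossings it accounts for. In a `321`-avoiding
permutation this number is the distance to the diagonal for points above it and zero otherwise; in a
`132`-avoiding one it is this distance, on both sides, truncated by the number of points to the
lower left. Removing points at the boundary of the graph shifts the diagonal relative to the
remaining points, so one keeps track of the numbers `a` and `b` of extreme rows and columns in which
the permutation is constrained. Up to monomial factors, both families of weight sums then satisfy
the recursion of the weighted Motzkin paths summed up in `motzkinSum`, and for `a = b = 0` they are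
the generating polynomials of the two avoidance classes.

The remaining equivalences come from the symmetries of the square: the reflection in the
anti-diagonal preserves all five statistics and exchanges `132` and `213`, and inversion preserves
`fp`, `inv` and `nes` and exchanges `231` and `312`. There are no further equivalences because in
length three a pattern is the only permutation that it excludes, so equivalent patterns have the
same statistics.
-/

namespace PermPattern

open Finset
open Equiv (Perm)

theorem mem_avoiders_singleton {k n : ℕ} {τ : Perm (Fin k)} {σ : Perm (Fin n)} :
    σ ∈ avoiders {⟨k, τ⟩} n ↔ ¬ Contains σ τ := by
  simp [avoiders]

theorem contains_iff_exists_strictMono {k n : ℕ} {σ : Perm (Fin n)} {τ : Perm (Fin k)} :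
    Contains σ τ ↔ ∃ f : Fin k → Fin n, StrictMono f ∧ StrictMono fun a => σ (f (τ⁻¹ a)) := by
  refine exists_congr fun f => and_congr_right fun _ => ⟨fun h a b hab => ?_, fun h a b => ?_⟩
  · simpa [h] using hab
  · simpa using h.lt_iff_lt (a := τ a) (b := τ b)

theorem contains_iff_eq {k : ℕ} {σ τ : Perm (Fin k)} : Contains σ τ ↔ σ = τ := by
  constructor
  · rintro ⟨f, hf, h⟩
    obtain rfl : f = id := (hf.range_inj strictMono_id).1 <| by
      rw [(Finite.surjective_of_injective hf.injective).range_eq, Set.range_id]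
    have hmono : StrictMono (σ * τ⁻¹) := fun a b hab => by
      simpa using (h (τ⁻¹ a) (τ⁻¹ b)).2 (by simpa using hab)
    have hid : ⇑(σ * τ⁻¹) = id := (hmono.range_inj strictMono_id).1 <| by
      rw [(σ * τ⁻¹).surjective.range_eq, Set.range_id]
    exact mul_inv_eq_one.1 (Equiv.ext (congrFun hid))
  · rintro rfl
    exact ⟨id, strictMono_id, fun _ _ => Iff.rfl⟩

theorem Contains.inverse {k n : ℕ} {σ : Perm (Fin n)} {τ : Perm (Fin k)}
    (h : Contains σ τ) : Contains σ⁻¹ τ⁻¹ := by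
  obtain ⟨f, hf, h⟩ := contains_iff_exists_strictMono.1 h
  exact contains_iff_exists_strictMono.2 ⟨fun a => σ (f (τ⁻¹ a)), h, by simpa using hf⟩

theorem contains_inverse_iff {k n : ℕ} {σ : Perm (Fin n)} {τ : Perm (Fin k)} :
    Contains σ⁻¹ τ⁻¹ ↔ Contains σ τ :=
  ⟨fun h => by simpa using h.inverse, Contains.inverse⟩

/-- The reflection of the graph of a permutation in the anti-diagonal. -/
def antiTranspose {n : ℕ} (σ : Perm (Fin n)) : Perm (Fin n) :=
  Fin.revPerm * σ⁻¹ * Fin.revPerm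

theorem antiTranspose_antiTranspose {n : ℕ} (σ : Perm (Fin n)) :
    antiTranspose (antiTranspose σ) = σ := by
  ext i
  simp [antiTranspose]

theorem antiTranspose_apply_rev {n : ℕ} (σ : Perm (Fin n)) (i : Fin n) :
    antiTranspose σ (σ i).rev = i.rev := by
  simp [antiTranspose]

theorem Contains.antiTranspose {k n : ℕ} {σ : Perm (Fin n)} {τ : Perm (Fin k)}
    (h : Contains σ τ) : Contains (antiTranspose σ) (antiTranspose τ) := by
  obtain ⟨f, hf, h⟩ := h.inverse
  refine ⟨fun a => (f a.rev).rev, fun a b hab => ?_, fun a b => ?_⟩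
  · simpa using hf (Fin.rev_lt_rev.2 hab)
  · simpa [PermPattern.antiTranspose] using h b.rev a.rev

theorem contains_antiTranspose_iff {k n : ℕ} {σ : Perm (Fin n)} {τ : Perm (Fin k)} :
    Contains (antiTranspose σ) (antiTranspose τ) ↔ Contains σ τ :=
  ⟨fun h => by simpa [antiTranspose_antiTranspose] using h.antiTranspose, Contains.antiTranspose⟩

section WilfEquiv

variable {ι : Type*} [Fintype ι] {st : ι → Stat}

theorem WilfEquiv.refl (T : Set (Σ k : ℕ, Perm (Fin k))) : WilfEquiv st T T := fun _ => rfl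

theorem WilfEquiv.symm {T T' : Set (Σ k : ℕ, Perm (Fin k))} (h : WilfEquiv st T T') :
    WilfEquiv st T' T := fun n => (h n).symm

theorem WilfEquiv.trans {T T' T'' : Set (Σ k : ℕ, Perm (Fin k))} (h : WilfEquiv st T T')
    (h' : WilfEquiv st T' T'') : WilfEquiv st T T'' := fun n => (h n).trans (h' n)

theorem WilfEquiv.of_equiv {k k' : ℕ} {τ : Perm (Fin k)} {τ' : Perm (Fin k')}
    (F : ∀ n, Perm (Fin n) ≃ Perm (Fin n)) (hF : ∀ n σ, Contains (F n σ) τ' ↔ Contains σ τ)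
    (hst : ∀ i n σ, st i n (F n σ) = st i n σ) : WilfEquiv st {⟨k, τ⟩} {⟨k', τ'⟩} := by
  intro n
  refine Finset.sum_equiv (F n) (fun σ => ?_) (fun σ _ => ?_)
  · simp [mem_avoiders_singleton, hF]
  · simp [hst]

theorem prod_X_pow_injective (R : Type*) [CommSemiring R] [Nontrivial R] :
    Function.Injective fun a : ι → ℕ => ∏ i, (MvPolynomial.X i : MvPolynomial ι R) ^ a i := by
  have hmonomial (a : ι → ℕ) : ∏ i, (MvPolynomial.X i : MvPolynomial ι R) ^ a i =
      MvPolynomial.monomial (Finsupp.equivFunOnFinite.symm a) 1 := by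
    rw [MvPolynomial.monomial_eq, Finsupp.prod_fintype _ _ (by simp)]
    simp
  simp only [hmonomial]
  exact (MvPolynomial.monomial_left_injective one_ne_zero).comp
    Finsupp.equivFunOnFinite.symm.injective

/-- In length `k` the only permutation excluded by a pattern of length `k` is the pattern itself,
so equal generating polynomials force equal monomials of the patterns. -/
theorem WilfEquiv.stat_eq {k : ℕ} {τ τ' : Perm (Fin k)}
    (h : WilfEquiv st {⟨k, τ⟩} {⟨k, τ'⟩}) (i : ι) : st i k τ = st i k τ' := by
  have hgenPoly (ρ : Perm (Fin k)) : genPoly st {⟨k, ρ⟩} k =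
      ∑ σ, (∏ i, MvPolynomial.X i ^ st i k σ) - ∏ i, MvPolynomial.X i ^ st i k ρ := by
    have : avoiders {⟨k, ρ⟩} k = univ.erase ρ := by
      ext σ
      simp [mem_avoiders_singleton, contains_iff_eq]
    rw [genPoly, this, ← sum_erase_add _ _ (mem_univ ρ), add_sub_cancel_right]
  have hk := h k
  rw [hgenPoly, hgenPoly, sub_right_inj] at hk
  exact congrFun (prod_X_pow_injective ℤ hk) i

theorem wilfClass_eq {k : ℕ} {τ : Perm (Fin k)} {C : Set (Perm (Fin k))}
    (hequiv : ∀ τ' ∈ C, WilfEquiv st {⟨k, τ⟩} {⟨k, τ'⟩})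
    (hstat : ∀ τ', (∀ i, st i k τ = st i k τ') → τ' ∈ C) : wilfClass st τ = C :=
  Set.Subset.antisymm (fun τ' h => hstat τ' (WilfEquiv.stat_eq h)) hequiv

theorem wilfClass_eq_of_mem {k : ℕ} {τ ρ : Perm (Fin k)} (h : τ ∈ wilfClass st ρ) :
    wilfClass st τ = wilfClass st ρ :=
  Set.ext fun _ => ⟨WilfEquiv.trans h, WilfEquiv.trans (WilfEquiv.symm h)⟩

theorem nonSingletonClasses_eq {k : ℕ} {S : Set (Set (Perm (Fin k)))}
    (hS : ∀ C ∈ S, C.Nontrivial ∧ ∃ τ, C = wilfClass st τ)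
    (hstat : ∀ τ τ', τ ≠ τ' → (∀ i, st i k τ = st i k τ') → ∃ C ∈ S, τ ∈ C) :
    nonSingletonClasses st k = S := by
  ext C
  constructor
  · rintro ⟨⟨τ, rfl⟩, hC⟩
    obtain ⟨τ', hτ', hne⟩ := hC.exists_ne τ
    obtain ⟨D, hD, hτD⟩ := hstat τ τ' hne.symm (WilfEquiv.stat_eq hτ')
    obtain ⟨-, ρ, rfl⟩ := hS D hD
    rwa [wilfClass_eq_of_mem hτD]
  · intro hC
    exact ⟨(hS C hC).2, (hS C hC).1⟩

end WilfEquiv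

section AntiTranspose

variable {n : ℕ} (σ : Perm (Fin n))

/-- The column of `antiTranspose σ` to which the reflection in the anti-diagonal sends the point
of the graph of `σ` in a given column. -/
def antiIndex : Perm (Fin n) := Fin.revPerm * σ

@[simp]
theorem antiIndex_apply (i : Fin n) : antiIndex σ i = (σ i).rev := by
  simp [antiIndex]

theorem fp_antiTranspose : fp n (antiTranspose σ) = fp n σ := by
  refine (card_equiv (antiIndex σ) fun i => ?_).symm
  simp [antiTranspose_apply_rev, eq_comm]

theorem exc_antiTranspose : exc n (antiTranspose σ) = exc n σ := by
  refine (card_equiv (antiIndex σ) fun i => ?_).symm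
  simp [antiTranspose_apply_rev]

theorem inv_antiTranspose : inv n (antiTranspose σ) = inv n σ := by
  refine (card_equiv ((antiIndex σ).prodCongr (antiIndex σ)) fun p => ?_).symm
  simp [antiTranspose_apply_rev, and_comm]

theorem crs_antiTranspose : crs n (antiTranspose σ) = crs n σ := by
  refine (card_equiv (((antiIndex σ).prodCongr (antiIndex σ)).trans
    (Equiv.prodComm _ _)) fun p => ?_).symm
  simp only [antiTranspose_apply_rev, antiIndex_apply, mem_filter_univ, Equiv.trans_apply,
    Equiv.prodCongr_apply, Prod.map_fst, Prod.map_snd, Equiv.coe_prodComm, Prod.fst_swap,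
    Prod.snd_swap, Fin.rev_lt_rev, Fin.rev_le_rev]
  tauto

theorem nes_antiTranspose : nes n (antiTranspose σ) = nes n σ := by
  refine (card_equiv ((antiIndex σ).prodCongr (antiIndex σ)) fun p => ?_).symm
  simp only [antiTranspose_apply_rev, antiIndex_apply, mem_filter_univ, Equiv.prodCongr_apply,
    Prod.map_fst, Prod.map_snd, Fin.rev_lt_rev, Fin.rev_le_rev]
  tauto

end AntiTranspose

theorem card_pairs_eq_sum {α β : Type*} [Fintype α] [Fintype β] (p : α → β → Prop)
    [∀ a b, Decidable (p a b)] :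
    #{x : α × β | p x.1 x.2} = ∑ a, #{b | p a b} := by
  simp only [card_filter, Fintype.sum_prod_type]

section Inverse

variable {n : ℕ} (σ : Perm (Fin n))

theorem inv_apply_eq_self_iff (i : Fin n) : σ⁻¹ i = i ↔ σ i = i := by
  rw [Equiv.Perm.inv_eq_iff_eq, eq_comm]

theorem fp_inverse : fp n σ⁻¹ = fp n σ := by
  simp only [fp, inv_apply_eq_self_iff]

theorem inv_inverse : inv n σ⁻¹ = inv n σ := by
  refine (card_equiv ((σ.prodCongr σ).trans (Equiv.prodComm _ _)) fun p => ?_).symm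
  simp [and_comm]

theorem card_le_lt_eq_card_lt_le (k : Fin n) :
    #{i | i ≤ k ∧ k < σ i} = #{i | k < i ∧ σ i ≤ k} := by
  have hcard : #{i | i ≤ k} = #{i | σ i ≤ k} := card_equiv σ⁻¹ fun i => by simp
  have := card_sdiff_comm hcard
  simpa [sdiff_eq_filter, filter_filter, and_comm] using this

theorem exists_le_lt_apply_iff (k : Fin n) :
    (∃ i, i ≤ k ∧ k < σ i) ↔ ∃ j, k < j ∧ σ j ≤ k := by
  have h := congrArg (0 < ·) (card_le_lt_eq_card_lt_le σ k)
  simpa [card_pos, Finset.Nonempty] using h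

theorem card_lt_and_inverse_le (k : Fin n) :
    #{i | k < i ∧ σ⁻¹ i ≤ k} = #{i | k < i ∧ σ i ≤ k} := by
  rw [← card_le_lt_eq_card_lt_le]
  refine (card_equiv σ fun i => ?_).symm
  simp [and_comm]

theorem card_upper_nestings_inverse :
    #{p : Fin n × Fin n | p.1 < p.2 ∧ p.2 < σ⁻¹ p.2 ∧ σ⁻¹ p.2 < σ⁻¹ p.1} =
      #{p : Fin n × Fin n | σ p.2 < σ p.1 ∧ σ p.1 < p.1 ∧ p.1 < p.2} := by
  refine (card_equiv ((σ.prodCongr σ).trans (Equiv.prodComm _ _)) fun p => ?_).symm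
  simp

theorem card_fixed_nestings :
    #{p : Fin n × Fin n | σ p.2 < σ p.1 ∧ σ p.1 = p.1 ∧ p.1 < p.2} =
      ∑ i with σ i = i, #{j | i < j ∧ σ j ≤ i} := by
  rw [card_pairs_eq_sum fun i j => σ j < σ i ∧ σ i = i ∧ i < j, sum_filter]
  refine sum_congr rfl fun i _ => ?_
  split_ifs with hi
  · congr 1 with j
    have hne : i < j → σ j ≠ i := fun hij h => hij.ne' (σ.injective (h.trans hi.symm))
    simp only [mem_filter, mem_univ, true_and, hi]
    exact ⟨fun h => ⟨h.2, h.1.le⟩, fun h => ⟨lt_of_le_of_ne h.2 (hne h.1), h.1⟩⟩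
  · simp [hi]

theorem nes_eq_add :
    nes n σ = #{p : Fin n × Fin n | p.1 < p.2 ∧ p.2 < σ p.2 ∧ σ p.2 < σ p.1} +
      #{p : Fin n × Fin n | σ p.2 < σ p.1 ∧ σ p.1 < p.1 ∧ p.1 < p.2} +
      ∑ i with σ i = i, #{j | i < j ∧ σ j ≤ i} := by
  rw [← card_fixed_nestings, nes, ← card_union_of_disjoint, ← card_union_of_disjoint]
  · congr 1 with p
    grind
  · rw [disjoint_left]
    grind
  · rw [disjoint_left]
    grind

theorem nes_inverse : nes n σ⁻¹ = nes n σ := by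
  have hlower := card_upper_nestings_inverse σ⁻¹
  rw [inv_inv] at hlower
  simp only [nes_eq_add, card_upper_nestings_inverse, ← hlower, inv_apply_eq_self_iff,
    card_lt_and_inverse_le]
  omega

end Inverse

section InsertPoint

variable {n : ℕ}

/-- The permutation obtained from `σ` by adding to its graph a new point in column `c` and
row `v`; the old points in columns `≥ c` move to the right and those in rows `≥ v` move up. -/
def insertPoint (c v : Fin (n + 1)) (σ : Perm (Fin n)) : Perm (Fin (n + 1)) :=
  (finSuccEquiv' c).trans (σ.optionCongr.trans (finSuccEquiv' v).symm)

@[simp]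
theorem insertPoint_apply_self (c v : Fin (n + 1)) (σ : Perm (Fin n)) :
    insertPoint c v σ c = v := by
  simp [insertPoint]

@[simp]
theorem insertPoint_apply_succAbove (c v : Fin (n + 1)) (σ : Perm (Fin n)) (i : Fin n) :
    insertPoint c v σ (c.succAbove i) = v.succAbove (σ i) := by
  simp [insertPoint]

theorem insertPoint_inv (c v : Fin (n + 1)) (σ : Perm (Fin n)) :
    (insertPoint c v σ)⁻¹ = insertPoint v c σ⁻¹ :=
  rfl

theorem insertPoint_injective (c v : Fin (n + 1)) : Function.Injective (insertPoint c v) := by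
  intro σ τ h
  ext i
  have := congrArg (fun ρ => ρ (c.succAbove i)) h
  simp only [insertPoint_apply_succAbove, Fin.succAbove_right_inj] at this
  rw [this]

theorem exists_insertPoint_eq {c v : Fin (n + 1)} {σ : Perm (Fin (n + 1))} (h : σ c = v) :
    ∃ τ, insertPoint c v τ = σ := by
  refine ⟨((finSuccEquiv' c).symm.trans (σ.trans (finSuccEquiv' v))).removeNone, ?_⟩
  ext i
  simp [insertPoint, map_equiv_removeNone, h]

theorem forall_fin_insertPoint_iff {c v : Fin (n + 1)} {σ : Perm (Fin n)}
    {p : ℕ → ℕ → Prop} :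
    (∀ i : Fin (n + 1), p i (insertPoint c v σ i)) ↔
      p c v ∧ ∀ i : Fin n, p (c.succAbove i) (v.succAbove (σ i)) := by
  rw [Fin.forall_iff_succAbove c]
  simp

theorem val_succAbove (c : Fin (n + 1)) (i : Fin n) :
    (c.succAbove i : ℕ) = if (i : ℕ) < c then (i : ℕ) else i + 1 := by
  rw [Fin.succAbove, apply_ite Fin.val]
  rfl

open Classical in
theorem sum_filter_apply_eq {M : Type*} [AddCommMonoid M] (c v : Fin (n + 1))
    (P : Perm (Fin (n + 1)) → Prop) (F : Perm (Fin (n + 1)) → M) :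
    ∑ σ with P σ ∧ σ c = v, F σ = ∑ σ with P (insertPoint c v σ), F (insertPoint c v σ) := by
  refine (sum_bij (fun σ _ => insertPoint c v σ) ?_ ?_ ?_ ?_).symm
  · intro σ hσ
    simpa using hσ
  · intro σ _ τ _ h
    exact insertPoint_injective c v h
  · intro σ hσ
    obtain ⟨τ, rfl⟩ := exists_insertPoint_eq (mem_filter.1 hσ).2.2
    exact ⟨τ, by simpa using hσ, rfl⟩
  · intro σ _
    rfl

end InsertPoint

section LowerLeft

variable {n : ℕ}

/-- The number of points of the graph of `σ` to the lower left of the point in column `j`. -/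
def lowerLeft (σ : Perm (Fin n)) (j : Fin n) : ℕ :=
  #{i | i < j ∧ σ i < σ j}

theorem lowerLeft_inverse (σ : Perm (Fin n)) (j : Fin n) :
    lowerLeft σ⁻¹ (σ j) = lowerLeft σ j := by
  refine (card_equiv σ fun i => ?_).symm
  simp [and_comm]

theorem lowerLeft_insertPoint_succAbove (c v : Fin (n + 1)) (σ : Perm (Fin n)) (j : Fin n) :
    lowerLeft (insertPoint c v σ) (c.succAbove j) =
      if (c : ℕ) ≤ j ∧ (v : ℕ) ≤ σ j then lowerLeft σ j + 1 else lowerLeft σ j := by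
  rw [lowerLeft, lowerLeft, card_filter, card_filter, Fin.sum_univ_succAbove _ c]
  simp only [insertPoint_apply_self, insertPoint_apply_succAbove, Fin.succAbove_lt_succAbove_iff,
    Fin.lt_succAbove_iff_le_castSucc, Fin.le_def, Fin.val_castSucc]
  split_ifs <;> simp [add_comm]

theorem lowerLeft_insertPoint_zero (v : Fin (n + 1)) (σ : Perm (Fin n)) :
    lowerLeft (insertPoint 0 v σ) 0 = 0 := by
  simp [lowerLeft]

theorem lowerLeft_insertPoint_last (σ : Perm (Fin n)) :
    lowerLeft (insertPoint (Fin.last n) (Fin.last n) σ) (Fin.last n) = n := by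
  rw [lowerLeft, card_filter, Fin.sum_univ_succAbove _ (Fin.last n)]
  simp [-Fin.succAbove_last, Fin.succAbove_lt_iff_castSucc_lt, Fin.castSucc_lt_last]

end LowerLeft

section WeightSum

variable {R : Type*} {N : ℕ}

/-- The weight that the points of `σ` get in `insertPoint c v σ`. -/
def shiftWeight (c v : ℕ) (φ : ℕ → ℕ → ℕ → R) (j w m : ℕ) : R :=
  φ (if j < c then j else j + 1) (if w < v then w else w + 1) (if c ≤ j ∧ v ≤ w then m + 1 else m)

theorem shiftWeight_last {j w : ℕ} (hj : j < N) (hw : w < N) (φ : ℕ → ℕ → ℕ → R) (m : ℕ) :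
    shiftWeight N N φ j w m = φ j w m := by
  rw [shiftWeight, if_pos hj, if_pos hw, if_neg (by omega)]

variable [CommSemiring R]

open Classical in
/-- The sum over the permutations satisfying `P` of the products of the weights of the points of
their graphs, where the weight `φ j w m` of a point may depend on its column `j`, its row `w` and
the number `m` of points to its lower left. -/
noncomputable def weightSum (P : Perm (Fin N) → Prop) (φ : ℕ → ℕ → ℕ → R) : R :=
  ∑ σ with P σ, ∏ j : Fin N, φ j (σ j) (lowerLeft σ j)

theorem weightSum_congr {P Q : Perm (Fin N) → Prop} {φ ψ : ℕ → ℕ → ℕ → R}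
    (hPQ : ∀ σ, P σ ↔ Q σ)
    (h : ∀ σ, P σ → ∀ j : Fin N, φ j (σ j) (lowerLeft σ j) = ψ j (σ j) (lowerLeft σ j)) :
    weightSum P φ = weightSum Q ψ := by
  obtain rfl : P = Q := funext fun σ => propext (hPQ σ)
  classical
  exact sum_congr rfl fun σ hσ => prod_congr rfl fun j _ => h σ (mem_filter.1 hσ).2 j

theorem weightSum_eq_zero {P : Perm (Fin N) → Prop} (hP : ∀ σ, ¬ P σ) (φ : ℕ → ℕ → ℕ → R) :
    weightSum P φ = 0 := by
  simp [weightSum, hP]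

theorem weightSum_of_length_zero {P : Perm (Fin 0) → Prop} (hP : ∀ σ, P σ)
    (φ : ℕ → ℕ → ℕ → R) : weightSum P φ = 1 := by
  simp [weightSum, hP]

theorem weightSum_eq_mul {P : Perm (Fin N) → Prop} {φ ψ : ℕ → ℕ → ℕ → R} {z : R}
    {g : Perm (Fin N) → Fin N → R} (hg : ∀ σ, ∏ j, g σ j = z)
    (h : ∀ σ, P σ → ∀ j : Fin N, φ j (σ j) (lowerLeft σ j) = g σ j * ψ j (σ j) (lowerLeft σ j)) :
    weightSum P φ = z * weightSum P ψ := by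
  classical
  rw [weightSum, weightSum, mul_sum]
  refine sum_congr rfl fun σ hσ => ?_
  rw [← hg σ, ← prod_mul_distrib]
  exact prod_congr rfl fun j _ => h σ (mem_filter.1 hσ).2 j

theorem prod_ite_le_val_add {b : ℕ} (hb : b ≤ N) (q : R) :
    ∏ j : Fin N, (if N ≤ (j : ℕ) + b then q else 1) = q ^ b := by
  have hcard : #{j : Fin N | N ≤ (j : ℕ) + b} = b := by
    have := card_filter_add_card_filter_not (s := univ) fun j : Fin N => (j : ℕ) < N - b
    simp only [Fin.card_filter_val_lt, card_univ, Fintype.card_fin, not_lt, tsub_le_iff_right]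
      at this
    omega
  rw [prod_ite, prod_const, prod_const_one, mul_one, hcard]

theorem weightSum_eq_pow_mul_of_last_columns {P : Perm (Fin N) → Prop} {φ ψ : ℕ → ℕ → ℕ → R}
    {b : ℕ} (hb : b ≤ N) (q : R)
    (h : ∀ σ, P σ → ∀ j : Fin N, φ j (σ j) (lowerLeft σ j) =
      (if N ≤ (j : ℕ) + b then q else 1) * ψ j (σ j) (lowerLeft σ j)) :
    weightSum P φ = q ^ b * weightSum P ψ :=
  weightSum_eq_mul (fun _ => prod_ite_le_val_add hb q) h

theorem weightSum_eq_pow_mul_of_top_rows {P : Perm (Fin N) → Prop} {φ ψ : ℕ → ℕ → ℕ → R}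
    {a : ℕ} (ha : a ≤ N) (q : R)
    (h : ∀ σ, P σ → ∀ j : Fin N, φ j (σ j) (lowerLeft σ j) =
      (if N ≤ (σ j : ℕ) + a then q else 1) * ψ j (σ j) (lowerLeft σ j)) :
    weightSum P φ = q ^ a * weightSum P ψ :=
  weightSum_eq_mul (fun σ => (Equiv.prod_comp σ fun w : Fin N =>
    if N ≤ (w : ℕ) + a then q else 1).trans (prod_ite_le_val_add ha q)) h

theorem prod_insertPoint (c v : Fin (N + 1)) (σ : Perm (Fin N)) (φ : ℕ → ℕ → ℕ → R) :
    ∏ j : Fin (N + 1), φ j (insertPoint c v σ j) (lowerLeft (insertPoint c v σ) j) =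
      φ c v (lowerLeft (insertPoint c v σ) c) *
        ∏ j : Fin N, shiftWeight c v φ j (σ j) (lowerLeft σ j) := by
  simp only [Fin.prod_univ_succAbove _ c, insertPoint_apply_self, insertPoint_apply_succAbove,
    lowerLeft_insertPoint_succAbove, val_succAbove, shiftWeight]

theorem weightSum_eq_add (c v : Fin (N + 1)) {P P₁ : Perm (Fin (N + 1)) → Prop}
    {P₀ : Perm (Fin N) → Prop} {φ : ℕ → ℕ → ℕ → R} {z : R}
    (hne : ∀ σ, P₁ σ ↔ P σ ∧ σ c ≠ v) (heq : ∀ σ, P₀ σ ↔ P (insertPoint c v σ))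
    (hz : ∀ σ, φ c v (lowerLeft (insertPoint c v σ) c) = z) :
    weightSum P φ = weightSum P₁ φ + z * weightSum P₀ (shiftWeight c v φ) := by
  classical
  rw [weightSum, ← sum_filter_add_sum_filter_not _ (fun σ => σ c = v), filter_filter,
    filter_filter, add_comm, weightSum, weightSum]
  simp only [hne, heq, sum_filter_apply_eq, prod_insertPoint, hz, mul_sum, ne_eq]

end WeightSum

/-- The sums of the weights of the Motzkin paths of length `t` from height `h` to height `0`,
with step weights chosen so that both the `321`- and the `132`-avoiding permutations of length `n`
have weight sum `motzkinSum x y q n 0`. -/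
def motzkinSum {R : Type*} [CommSemiring R] (x y q : R) : ℕ → ℕ → R
  | 0, 0 => 1
  | 0, _ + 1 => 0
  | t + 1, 0 => x * motzkinSum x y q t 0 + y * motzkinSum x y q t 1
  | t + 1, h + 1 => motzkinSum x y q t h + y * q ^ h * motzkinSum x y q t (h + 1) +
      q ^ (h + 1) * (motzkinSum x y q t (h + 1) + y * q ^ (h + 1) * motzkinSum x y q t (h + 2))

/-- The sums of the weights of the Motzkin paths with half of a step in front: two consecutive
half steps, one between integral and half-integral heights each, make up a step of
`motzkinSum`. -/
def motzkinHalfSum {R : Type*} [CommSemiring R] (x y q : R) (t h : ℕ) : R :=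
  motzkinSum x y q t h + y * q ^ h * motzkinSum x y q t (h + 1)

theorem motzkinSum_succ_succ {R : Type*} [CommSemiring R] (x y q : R) (t h : ℕ) :
    motzkinSum x y q (t + 1) (h + 1) =
      motzkinHalfSum x y q t h + q ^ (h + 1) * motzkinHalfSum x y q t (h + 1) :=
  rfl

section Avoids321

/-- The permutations without decreasing subsequence of length three. -/
def Avoids321 {n : ℕ} (σ : Perm (Fin n)) : Prop :=
  ∀ i j k, i < j → j < k → σ j < σ i → ¬ σ k < σ j

theorem not_contains_p321_iff {n : ℕ} {σ : Perm (Fin n)} :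
    ¬ Contains σ p321 ↔ Avoids321 σ := by
  rw [contains_iff_exists_strictMono]
  constructor
  · intro h i j k hij hjk hji hkj
    refine h ⟨![i, j, k], ?_, ?_⟩
    · simp [Fin.strictMono_iff_lt_succ, Fin.forall_fin_two, hij, hjk]
    · simpa [Fin.strictMono_iff_lt_succ, Fin.forall_fin_two] using ⟨hkj, hji⟩
  · rintro h ⟨f, hf, hσ⟩
    exact h (f 0) (f 1) (f 2) (hf (by decide)) (hf (by decide)) (hσ (a := 1) (b := 2) (by decide))
      (hσ (a := 0) (b := 1) (by decide))

variable {N a b : ℕ}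

theorem Avoids321.inverse {σ : Perm (Fin N)} (h : Avoids321 σ) : Avoids321 σ⁻¹ := by
  intro i j k hij hjk hji hkj
  exact h (σ⁻¹ k) (σ⁻¹ j) (σ⁻¹ i) hkj hji (by simpa using hjk) (by simpa using hij)

theorem Avoids321.apply_ne {σ : Perm (Fin N)} (hσ : Avoids321 σ) {i j : Fin N} (hij : i < j)
    (hji : j < σ i) : σ j ≠ j := by
  intro hj
  obtain ⟨k, hjk, hkj⟩ := (exists_le_lt_apply_iff σ j).1 ⟨i, hij.le, hji⟩
  refine hσ i j k hij hjk (hj.symm ▸ hji) (hj.symm ▸ lt_of_le_of_ne hkj fun h => ?_)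
  exact hjk.ne (σ.injective (hj.trans h.symm))

theorem Avoids321.of_insertPoint {c v : Fin (N + 1)} {σ : Perm (Fin N)}
    (h : Avoids321 (insertPoint c v σ)) : Avoids321 σ := by
  intro i j k
  simpa using h (c.succAbove i) (c.succAbove j) (c.succAbove k)

theorem avoids321_insertPoint_last_iff {c : Fin (N + 1)} {σ : Perm (Fin N)} :
    Avoids321 (insertPoint c (Fin.last N) σ) ↔
      Avoids321 σ ∧ ∀ j k, c ≤ j.castSucc → j < k → σ j < σ k := by
  constructor
  · refine fun h => ⟨h.of_insertPoint, fun j k hcj hjk => ?_⟩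
    have hjk' := h c (c.succAbove j) (c.succAbove k) (Fin.lt_succAbove_iff_le_castSucc _ _ |>.2 hcj)
      (by simpa) (by simp [Fin.castSucc_lt_last])
    refine lt_of_le_of_ne (by simpa using hjk') fun h => hjk.ne (σ.injective h)
  · rintro ⟨hσ, hmono⟩ i j k hij hjk hji hkj
    rcases Fin.eq_self_or_eq_succAbove c j with rfl | ⟨j, rfl⟩
    · rw [insertPoint_apply_self] at hji
      exact (Fin.le_last _).not_gt hji
    rcases Fin.eq_self_or_eq_succAbove c k with rfl | ⟨k, rfl⟩
    · rw [insertPoint_apply_self] at hkj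
      exact (Fin.le_last _).not_gt hkj
    simp only [insertPoint_apply_succAbove, Fin.succAbove_lt_succAbove_iff] at hjk hkj
    rcases Fin.eq_self_or_eq_succAbove c i with rfl | ⟨i, rfl⟩
    · exact (hmono j k (Fin.lt_succAbove_iff_le_castSucc _ _ |>.1 hij) hjk).asymm hkj
    · simp only [insertPoint_apply_succAbove, Fin.succAbove_lt_succAbove_iff] at hij hji
      exact hσ i j k hij hjk hji hkj

/-- The `321`-avoiding permutations of length `N` whose graph has no point both in the last `b`
columns and in the top `a` rows. -/
structure Corner321 (N a b : ℕ) (σ : Perm (Fin N)) : Prop where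
  avoids : Avoids321 σ
  corner : ∀ i : Fin N, (i : ℕ) + b < N ∨ (σ i : ℕ) + a < N

theorem Corner321.inverse {σ : Perm (Fin N)} (h : Corner321 N a b σ) : Corner321 N b a σ⁻¹ where
  avoids := h.avoids.inverse
  corner i := by simpa [or_comm] using h.corner (σ⁻¹ i)

theorem corner321_inverse_iff {σ : Perm (Fin N)} : Corner321 N b a σ⁻¹ ↔ Corner321 N a b σ :=
  ⟨fun h => by simpa using h.inverse, Corner321.inverse⟩

theorem corner321_zero_iff {σ : Perm (Fin N)} : Corner321 N a 0 σ ↔ Avoids321 σ :=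
  ⟨Corner321.avoids, fun h => ⟨h, fun i => Or.inl i.isLt⟩⟩

theorem apply_lt_apply_of_val_succ_eq {σ : Perm (Fin N)} {i t : Fin N} (ht : (σ t : ℕ) + 1 = N)
    (hit : i ≠ t) : σ i < σ t :=
  lt_of_le_of_ne (by rw [Fin.le_def]; omega) (σ.injective.ne hit)

theorem Corner321.exists_apply_eq_top {σ : Perm (Fin N)} (h : Corner321 N a b σ) (ha : a ≠ 0)
    (hN : 0 < N) : ∃ t, (σ t : ℕ) + 1 = N ∧ (t : ℕ) + b < N := by
  obtain ⟨t, ht⟩ := σ.surjective ⟨N - 1, by omega⟩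
  have htop : (σ t : ℕ) + 1 = N := by
    rw [ht]
    exact Nat.sub_add_cancel hN
  have := h.corner t
  exact ⟨t, htop, by omega⟩

theorem Corner321.apply_lt_apply {σ : Perm (Fin N)} (h : Corner321 N a b σ) (ha : a ≠ 0)
    {j k : Fin N} (hj : N ≤ j + b) (hjk : j < k) : σ j < σ k := by
  obtain ⟨t, ht, htb⟩ := h.exists_apply_eq_top ha j.pos
  have htj : t < j := by
    rw [Fin.lt_def]
    omega
  exact lt_of_le_of_ne
    (not_lt.1 (h.avoids t j k htj hjk (apply_lt_apply_of_val_succ_eq ht htj.ne')))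
    (σ.injective.ne hjk.ne)

theorem Corner321.apply_ne {σ : Perm (Fin N)} (h : Corner321 N a b σ) (ha : a ≠ 0)
    {j : Fin N} (hj : N ≤ j + b) : σ j ≠ j := by
  obtain ⟨t, ht, htb⟩ := h.exists_apply_eq_top ha j.pos
  have htj : t < j := by
    rw [Fin.lt_def]
    omega
  intro hfix
  refine h.avoids.apply_ne htj ?_ hfix
  simpa only [hfix] using apply_lt_apply_of_val_succ_eq ht htj.ne'

theorem corner321_insertPoint_iff {c : Fin (N + 1)} (hc : (c : ℕ) + b = N) (hab : a = 0 → b ≤ 1)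
    {σ : Perm (Fin N)} :
    Corner321 (N + 1) (a + 1) b (insertPoint c (Fin.last N) σ) ↔ Corner321 N a b σ := by
  have hcorner : (∀ i : Fin (N + 1), (i : ℕ) + b < N + 1 ∨
      (insertPoint c (Fin.last N) σ i : ℕ) + (a + 1) < N + 1) ↔
      ∀ i : Fin N, (i : ℕ) + b < N ∨ (σ i : ℕ) + a < N := by
    rw [forall_fin_insertPoint_iff (p := fun i w => i + b < N + 1 ∨ w + (a + 1) < N + 1)]
    refine ⟨fun h i => ?_, fun h => ⟨Or.inl (by omega), fun i => ?_⟩⟩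
    · have := h.2 i
      rw [val_succAbove, Fin.succAbove_last, Fin.val_castSucc] at this
      split_ifs at this <;> omega
    · have := h i
      rw [val_succAbove, Fin.succAbove_last, Fin.val_castSucc]
      split_ifs <;> omega
  refine ⟨fun h => ⟨h.avoids.of_insertPoint, hcorner.1 h.corner⟩, fun h =>
    ⟨avoids321_insertPoint_last_iff.2 ⟨h.avoids, fun j k hcj hjk => ?_⟩, hcorner.2 h.corner⟩⟩
  rw [Fin.le_def, Fin.val_castSucc] at hcj
  by_cases ha : a = 0
  · have := hab ha
    rw [Fin.lt_def] at hjk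
    omega
  · exact h.apply_lt_apply ha (by omega) hjk

theorem corner321_succ_iff {c : Fin (N + 1)} (hc : (c : ℕ) + b = N) (hba : b = 0 → a = 0)
    {σ : Perm (Fin (N + 1))} :
    Corner321 (N + 1) (a + 1) (b + 1) σ ↔
      Corner321 (N + 1) (a + 1) b σ ∧ σ c ≠ Fin.last N := by
  constructor
  · intro h
    refine ⟨⟨h.avoids, fun i => ?_⟩, fun heq => ?_⟩
    · have := h.corner i
      omega
    · have := h.corner c
      rw [heq, Fin.val_last] at this
      omega
  · rintro ⟨h, hne⟩
    refine ⟨h.avoids, fun i => ?_⟩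
    by_contra hi
    have hcorner := h.corner i
    obtain rfl : i = c := Fin.ext (by omega)
    obtain ⟨t, ht, htb⟩ := h.exists_apply_eq_top a.succ_ne_zero N.succ_pos
    have hti : t < i := by
      have hne' : (t : ℕ) ≠ i := fun heq => hne (Fin.ext_iff.2 (by
        rw [← Fin.ext heq, Fin.val_last]
        omega))
      rw [Fin.lt_def]
      omega
    have hb : b ≠ 0 := fun hb => by
      have := apply_lt_apply_of_val_succ_eq ht hti.ne'
      rw [Fin.lt_def] at this
      have := hba hb
      omega
    have hlast := h.corner (Fin.last N)
    rw [Fin.val_last] at hlast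
    refine h.avoids t i (Fin.last N) hti ?_ (apply_lt_apply_of_val_succ_eq ht hti.ne') ?_
    · rw [Fin.lt_def, Fin.val_last]
      omega
    · rw [Fin.lt_def]
      omega

theorem corner321_insertPoint_row_iff {r : Fin (N + 1)} (hr : (r : ℕ) + a = N)
    (hba : b = 0 → a ≤ 1) {σ : Perm (Fin N)} :
    Corner321 (N + 1) a (b + 1) (insertPoint (Fin.last N) r σ) ↔ Corner321 N a b σ := by
  rw [← corner321_inverse_iff, insertPoint_inv, corner321_insertPoint_iff hr hba,
    corner321_inverse_iff]

theorem corner321_succ_row_iff {r : Fin (N + 1)} (hr : (r : ℕ) + a = N) (hab : a = 0 → b = 0)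
    {σ : Perm (Fin (N + 1))} :
    Corner321 (N + 1) (a + 1) (b + 1) σ ↔
      Corner321 (N + 1) a (b + 1) σ ∧ σ (Fin.last N) ≠ r := by
  rw [← corner321_inverse_iff, corner321_succ_iff hr hab, corner321_inverse_iff, ne_eq,
    Equiv.Perm.inv_eq_iff_eq, eq_comm]

section WeightSum

variable {R : Type*} [CommSemiring R] (x y q : R)

/-- The weight of the point in column `j` and row `w` of the graph of a `321`-avoiding
permutation. Fixed points in columns `≥ c` do not get the factor `x`: after a point has been
removed, they stand for points below the diagonal of the original graph. -/
def weight321 (c j w _m : ℕ) : R :=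
  if j < w then y * q ^ (w - j - 1) else if j = w ∧ j < c then x else 1

/-- The weight sum of the permutations in `Corner321 N a b`. -/
noncomputable def cornerSum321 (N a b : ℕ) : R :=
  weightSum (Corner321 N a b) (weight321 x y q (N - b))

theorem weight321_of_le {c j w : ℕ} (m : ℕ) (hwj : w ≤ j) (hc : j = w → c ≤ j) :
    weight321 x y q c j w m = 1 := by
  rw [weight321, if_neg (by omega), if_neg (by omega)]

theorem weight321_succ_row {c j w m : ℕ} (hjw : j < w) :
    weight321 x y q c j (w + 1) m = q * weight321 x y q c j w m := by
  rw [weight321, weight321, if_pos (by omega), if_pos hjw,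
    show w + 1 - j - 1 = w - j - 1 + 1 by omega]
  ring

theorem cornerSum321_length_zero : cornerSum321 x y q 0 0 0 = 1 :=
  weightSum_of_length_zero (fun _ => ⟨fun i => i.elim0, fun i => i.elim0⟩) _

theorem cornerSum321_eq_zero (h : ℕ) : cornerSum321 x y q (h + 1) (h + 1) (h + 1) = 0 := by
  refine weightSum_eq_zero (fun σ hσ => ?_) _
  have := hσ.corner 0
  omega

theorem cornerSum321_succ_zero_zero (N : ℕ) :
    cornerSum321 x y q (N + 1) 0 0 =
      cornerSum321 x y q (N + 1) 1 1 + x * cornerSum321 x y q N 0 0 := by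
  have hzero (σ : Perm (Fin (N + 1))) : Corner321 (N + 1) 0 0 σ ↔ Corner321 (N + 1) 1 0 σ := by
    rw [corner321_zero_iff, corner321_zero_iff]
  have hpeel := weightSum_eq_add (Fin.last N) (Fin.last N) (φ := weight321 x y q (N + 1)) (z := x)
    (fun σ => corner321_succ_iff (a := 0) (b := 0) (by simp) (by simp))
    (fun σ => (corner321_insertPoint_iff (by simp) (by simp)).symm)
    (fun σ => by simp [weight321])
  simp only [cornerSum321, Nat.sub_zero, Nat.add_sub_cancel]
  rw [weightSum_congr hzero fun _ _ _ => rfl]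
  refine hpeel.trans (congrArg₂ _ ?_ (congrArg _ ?_))
  · refine weightSum_congr (fun _ => Iff.rfl) fun σ hσ j => ?_
    have := hσ.corner j
    simp only [weight321]
    split_ifs <;> first | rfl | omega
  · refine weightSum_congr (fun _ => Iff.rfl) fun σ _ j => ?_
    rw [Fin.val_last, shiftWeight_last j.isLt (σ j).isLt]
    have := j.isLt
    simp only [weight321]
    split_ifs <;> first | rfl | omega

theorem cornerSum321_odd {N h : ℕ} (hN : h ≤ N) :
    cornerSum321 x y q (N + 1) h (h + 1) =
      cornerSum321 x y q (N + 1) (h + 1) (h + 1) + q ^ h * cornerSum321 x y q N h h := by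
  obtain ⟨r, rfl⟩ := Nat.exists_eq_add_of_le' hN
  have hpeel := weightSum_eq_add (Fin.last (r + h)) ⟨r, by omega⟩ (φ := weight321 x y q r) (z := 1)
    (fun σ => corner321_succ_row_iff (b := h) rfl id)
    (fun σ => (corner321_insertPoint_row_iff rfl (by omega)).symm)
    (fun σ => weight321_of_le x y q _ (by simp) (by simp))
  simp only [cornerSum321, Nat.add_sub_cancel, show r + h + 1 - (h + 1) = r by omega]
  rw [hpeel, one_mul]
  congr 1
  refine weightSum_eq_pow_mul_of_top_rows hN q fun σ hσ j => ?_
  have hj := j.isLt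
  have hcorner := hσ.corner j
  simp only [shiftWeight, Fin.val_last, if_pos hj]
  by_cases hw : (σ j : ℕ) < r
  · rw [if_pos hw, if_neg (c := r + h ≤ _ + h) (by omega), one_mul]
    rfl
  · rw [if_neg hw, if_pos (c := r + h ≤ _ + h) (by omega),
      ← weight321_succ_row x y q (m := lowerLeft σ j) (by omega)]
    rfl

theorem cornerSum321_even {N h : ℕ} (hN : h + 1 ≤ N) :
    cornerSum321 x y q (N + 1) (h + 1) (h + 1) =
      cornerSum321 x y q (N + 1) (h + 1) (h + 2) +
        y * q ^ h * cornerSum321 x y q N h (h + 1) := by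
  obtain ⟨c, rfl⟩ := Nat.exists_eq_add_of_le' hN
  have hpoint (m : ℕ) : weight321 x y q (c + 1) c (c + (h + 1)) m = y * q ^ h := by
    rw [weight321, if_pos (by omega), show c + (h + 1) - c - 1 = h by omega]
  have hpeel := weightSum_eq_add ⟨c, by omega⟩ (Fin.last (c + (h + 1)))
    (φ := weight321 x y q (c + 1)) (z := y * q ^ h)
    (fun σ => corner321_succ_iff (a := h) (b := h + 1) rfl (by simp))
    (fun σ => (corner321_insertPoint_iff rfl (by omega)).symm) (fun σ => hpoint _)
  simp only [cornerSum321, Nat.add_sub_cancel, show c + (h + 1) + 1 - (h + 1) = c + 1 by omega,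
    show c + (h + 1) + 1 - (h + 2) = c by omega]
  refine hpeel.trans (congrArg₂ _ ?_ (congrArg _ ?_))
  · refine weightSum_congr (fun _ => Iff.rfl) fun σ hσ j => ?_
    have hfix : (j : ℕ) = c → (σ j : ℕ) ≠ j := fun hj heq =>
      hσ.apply_ne h.succ_ne_zero (by omega) (Fin.ext heq)
    simp only [weight321]
    split_ifs <;> first | rfl | omega
  · refine weightSum_congr (fun _ => Iff.rfl) fun σ hσ j => ?_
    have hcorner := hσ.corner j
    have hw := (σ j).isLt
    simp only [shiftWeight, weight321, Fin.val_last]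
    split_ifs <;> first | rfl | omega

theorem cornerSum321_succ_of_forall {t : ℕ}
    (ht : ∀ h, cornerSum321 x y q (t + h) h h =
      y ^ h * q ^ (h * (h - 1)) * motzkinSum x y q t h) (h : ℕ) :
    cornerSum321 x y q (t + h + 1) h (h + 1) =
      y ^ h * q ^ (h * h) * motzkinHalfSum x y q t h := by
  have hexp : q ^ h * q ^ (h * (h - 1)) = q ^ (h * h) := by
    rw [← pow_add]
    congr 1
    cases h <;> grind
  rw [cornerSum321_odd x y q (by omega), ht h, add_assoc, ht (h + 1), Nat.add_sub_cancel,
    motzkinHalfSum, mul_add, ← hexp]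
  calc _ = y ^ (h + 1) * (q ^ h * q ^ (h * h)) * motzkinSum x y q t (h + 1) +
        y ^ h * (q ^ h * q ^ (h * (h - 1))) * motzkinSum x y q t h := by ring
    _ = _ := by
      rw [← hexp]
      ring

theorem cornerSum321_eq (t : ℕ) : ∀ h, cornerSum321 x y q (t + h) h h =
    y ^ h * q ^ (h * (h - 1)) * motzkinSum x y q t h := by
  induction t with
  | zero =>
    rintro (_ | h)
    · simp [cornerSum321_length_zero, motzkinSum]
    · simp [cornerSum321_eq_zero, motzkinSum]
  | succ t ih =>
    rintro (_ | h)
    · have h0 : cornerSum321 x y q t 0 0 = motzkinSum x y q t 0 := by simpa using ih 0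
      have h1 : cornerSum321 x y q (t + 1) 1 1 = y * motzkinSum x y q t 1 := by simpa using ih 1
      rw [add_zero, cornerSum321_succ_zero_zero, h0, h1, motzkinSum]
      ring
    · rw [show t + 1 + (h + 1) = t + (h + 1) + 1 by ring, cornerSum321_even x y q (by omega),
        cornerSum321_succ_of_forall x y q ih (h + 1), ← add_assoc t,
        cornerSum321_succ_of_forall x y q ih h, motzkinSum_succ_succ, Nat.add_sub_cancel]
      ring

end WeightSum

end Avoids321

section Avoids132

/-- The permutations without subsequence in the relative order of `132`. -/
def Avoids132 {n : ℕ} (σ : Perm (Fin n)) : Prop :=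
  ∀ i j k, i < j → j < k → σ i < σ k → ¬ σ k < σ j

theorem not_contains_p132_iff {n : ℕ} {σ : Perm (Fin n)} :
    ¬ Contains σ p132 ↔ Avoids132 σ := by
  rw [contains_iff_exists_strictMono]
  constructor
  · intro h i j k hij hjk hik hkj
    refine h ⟨![i, j, k], ?_, ?_⟩
    · simp [Fin.strictMono_iff_lt_succ, Fin.forall_fin_two, hij, hjk]
    · simpa [Fin.strictMono_iff_lt_succ, Fin.forall_fin_two] using ⟨hik, hkj⟩
  · rintro h ⟨f, hf, hσ⟩
    exact h (f 0) (f 1) (f 2) (hf (by decide)) (hf (by decide)) (hσ (a := 0) (b := 1) (by decide))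
      (hσ (a := 1) (b := 2) (by decide))

variable {N a b : ℕ}

theorem Avoids132.inverse {σ : Perm (Fin N)} (h : Avoids132 σ) : Avoids132 σ⁻¹ := by
  intro i j k hij hjk hik hkj
  exact h (σ⁻¹ i) (σ⁻¹ k) (σ⁻¹ j) hik hkj (by simpa using hij) (by simpa using hjk)

theorem Avoids132.of_insertPoint {c v : Fin (N + 1)} {σ : Perm (Fin N)}
    (h : Avoids132 (insertPoint c v σ)) : Avoids132 σ := by
  intro i j k
  simpa using h (c.succAbove i) (c.succAbove j) (c.succAbove k)

theorem avoids132_insertPoint_zero_iff {v : Fin (N + 1)} {σ : Perm (Fin N)} :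
    Avoids132 (insertPoint 0 v σ) ↔
      Avoids132 σ ∧ ∀ i j, v ≤ (σ i).castSucc → σ i < σ j → i < j := by
  constructor
  · refine fun h => ⟨h.of_insertPoint, fun i j hvi hij => ?_⟩
    by_contra hji
    have hji : j < i := lt_of_le_of_ne (not_lt.1 hji) fun heq => hij.ne (by rw [heq])
    refine h 0 (Fin.succAbove 0 j) (Fin.succAbove 0 i) (by simp) (by simpa using hji) ?_
      (by simpa only [insertPoint_apply_succAbove, Fin.succAbove_lt_succAbove_iff])
    rw [insertPoint_apply_self, insertPoint_apply_succAbove]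
    exact (Fin.lt_succAbove_iff_le_castSucc _ _).2 hvi
  · rintro ⟨hσ, hmono⟩ i j k hij hjk hik hkj
    obtain ⟨k, rfl⟩ := Fin.exists_succAbove_eq ((Fin.zero_le _).trans_lt hjk).ne'
    obtain ⟨j, rfl⟩ := Fin.exists_succAbove_eq ((Fin.zero_le _).trans_lt hij).ne'
    simp only [insertPoint_apply_succAbove, Fin.succAbove_lt_succAbove_iff] at hjk hkj
    rcases Fin.eq_self_or_eq_succAbove 0 i with rfl | ⟨i, rfl⟩
    · rw [insertPoint_apply_self, insertPoint_apply_succAbove] at hik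
      exact (hmono k j ((Fin.lt_succAbove_iff_le_castSucc _ _).1 hik) hkj).asymm hjk
    · simp only [insertPoint_apply_succAbove, Fin.succAbove_lt_succAbove_iff] at hij hik
      exact hσ i j k hij hjk hik hkj

theorem avoids132_insertPoint_last_iff {σ : Perm (Fin N)} :
    Avoids132 (insertPoint (Fin.last N) (Fin.last N) σ) ↔ Avoids132 σ := by
  refine ⟨Avoids132.of_insertPoint, fun hσ i j k hij hjk hik hkj => ?_⟩
  obtain ⟨j, rfl⟩ := Fin.exists_succAbove_eq (hjk.trans_le (Fin.le_last _)).ne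
  obtain ⟨i, rfl⟩ := Fin.exists_succAbove_eq (hij.trans (hjk.trans_le (Fin.le_last _))).ne
  rcases Fin.eq_self_or_eq_succAbove (Fin.last N) k with rfl | ⟨k, rfl⟩
  · rw [insertPoint_apply_self] at hkj
    exact (Fin.le_last _).not_gt hkj
  · simp only [insertPoint_apply_succAbove, Fin.succAbove_lt_succAbove_iff] at hij hjk hik hkj
    exact hσ i j k hij hjk hik hkj

/-- The `132`-avoiding permutations of length `N`, where `a + b ≤ N`, whose graph has no point in
the first column in the top `a - 1` rows, no point in the bottom row in the last `b - 1` columns,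
and no point both in the last `b` columns and in the top `a` rows. -/
structure Corner132 (N a b : ℕ) (σ : Perm (Fin N)) : Prop where
  avoids : Avoids132 σ
  add_le : a + b ≤ N
  first_column : ∀ i : Fin N, (i : ℕ) = 0 → (σ i : ℕ) + a ≤ N
  bottom_row : ∀ i : Fin N, (σ i : ℕ) = 0 → (i : ℕ) + b ≤ N
  corner : ∀ i : Fin N, (i : ℕ) + b < N ∨ (σ i : ℕ) + a < N

theorem Corner132.inverse {σ : Perm (Fin N)} (h : Corner132 N a b σ) : Corner132 N b a σ⁻¹ where
  avoids := h.avoids.inverse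
  add_le := add_comm a b ▸ h.add_le
  first_column i hi := h.bottom_row _ (by simpa using hi)
  bottom_row i hi := by simpa using h.first_column _ hi
  corner i := by simpa [or_comm] using h.corner (σ⁻¹ i)

theorem corner132_inverse_iff {σ : Perm (Fin N)} : Corner132 N b a σ⁻¹ ↔ Corner132 N a b σ :=
  ⟨fun h => by simpa using h.inverse, Corner132.inverse⟩

theorem corner132_zero_zero_iff {σ : Perm (Fin N)} : Corner132 N 0 0 σ ↔ Avoids132 σ :=
  ⟨Corner132.avoids, fun h => ⟨h, N.zero_le, fun i _ => (σ i).isLt.le, fun i _ => i.isLt.le,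
    fun i => Or.inl i.isLt⟩⟩

theorem Avoids132.lt_of_apply_lt {σ : Perm (Fin N)} (hσ : Avoids132 σ)
    (hfirst : ∀ i : Fin N, (i : ℕ) = 0 → (σ i : ℕ) + a ≤ N) {i j : Fin N} (hi : N ≤ σ i + a)
    (hij : σ i < σ j) : i < j := by
  by_contra! hji
  have hji : j < i := lt_of_le_of_ne hji fun h => hij.ne (by rw [h])
  have hz := hfirst ⟨0, i.pos⟩ rfl
  have hzi : σ ⟨0, i.pos⟩ < σ i := by
    refine lt_of_le_of_ne (by rw [Fin.le_def]; omega) (σ.injective.ne (Fin.ne_of_val_ne ?_))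
    exact (Nat.zero_le _).trans_lt hji |>.ne
  refine hσ ⟨0, i.pos⟩ j i (Fin.lt_def.2 (Nat.pos_of_ne_zero fun hj => ?_)) hji hzi hij
  obtain rfl : j = ⟨0, i.pos⟩ := Fin.ext hj
  exact hzi.asymm hij

theorem Avoids132.position_bound {σ : Perm (Fin N)} (hσ : Avoids132 σ)
    (hfirst : ∀ i : Fin N, (i : ℕ) = 0 → (σ i : ℕ) + a ≤ N)
    (hcorner : ∀ i : Fin N, (i : ℕ) + b < N ∨ (σ i : ℕ) + a < N) {j : Fin N}
    (hj : N ≤ σ j + a) : (j : ℕ) + b ≤ σ j := by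
  obtain ⟨k, hk⟩ : ∃ k, (σ j : ℕ) + 1 + k = N := Nat.exists_eq_add_of_le (σ j).isLt |>.imp
    fun _ => Eq.symm
  induction k generalizing j with
  | zero =>
    have := hcorner j
    omega
  | succ k ih =>
    obtain ⟨j', hj'⟩ := σ.surjective ⟨σ j + 1, by omega⟩
    have hval : (σ j' : ℕ) = σ j + 1 := by rw [hj']
    have hjj' : j < j' := hσ.lt_of_apply_lt hfirst hj (by rw [Fin.lt_def]; omega)
    have := ih (j := j') (by omega) (by omega)
    rw [Fin.lt_def] at hjj'
    omega

theorem Corner132.position_bound {σ : Perm (Fin N)} (h : Corner132 N a b σ) {j : Fin N}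
    (hj : N ≤ σ j + a) : (j : ℕ) + b ≤ σ j :=
  h.avoids.position_bound h.first_column h.corner hj

theorem Avoids132.row_bound {σ : Perm (Fin N)} (hσ : Avoids132 σ)
    (hbottom : ∀ i : Fin N, (σ i : ℕ) = 0 → (i : ℕ) + b ≤ N)
    (hcorner : ∀ i : Fin N, (i : ℕ) + b < N ∨ (σ i : ℕ) + a < N) {j : Fin N}
    (hj : N ≤ j + b) : (σ j : ℕ) + a ≤ j := by
  have := hσ.inverse.position_bound (a := b) (b := a) (j := σ j)
    (fun i hi => hbottom _ (by simpa using hi))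
    (fun i => by simpa [or_comm] using hcorner (σ⁻¹ i)) (by simpa using hj)
  simpa using this

theorem Corner132.row_bound {σ : Perm (Fin N)} (h : Corner132 N a b σ) {j : Fin N}
    (hj : N ≤ j + b) : (σ j : ℕ) + a ≤ j :=
  h.avoids.row_bound h.bottom_row h.corner hj

theorem Corner132.of_succ {σ : Perm (Fin (N + 1))} (hσ : Avoids132 σ)
    (hfirst : (σ 0 : ℕ) + a ≤ N + 1)
    (hbottom : ∀ i : Fin (N + 1), (σ i : ℕ) = 0 → (i : ℕ) + b ≤ N + 1)
    (hcorner : ∀ i : Fin (N + 1), (i : ℕ) + b < N + 1 ∨ (σ i : ℕ) + a < N + 1) :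
    Corner132 (N + 1) a b σ where
  avoids := hσ
  first_column i hi := by rwa [show i = 0 from Fin.ext hi]
  bottom_row := hbottom
  corner := hcorner
  add_le := by
    rcases Nat.eq_zero_or_pos b with rfl | hb
    · omega
    · have hinv := hbottom (σ⁻¹ 0) (by simp)
      have := hσ.row_bound hbottom hcorner (j := ⟨N + 1 - b, by omega⟩) (by simp; omega)
      simp only at this
      omega

theorem Corner132.of_insertPoint {v : Fin (N + 1)} (hv : (v : ℕ) + a = N) {σ : Perm (Fin N)}
    (h : Corner132 (N + 1) (a + 1) b (insertPoint 0 v σ)) : Corner132 N a b σ := by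
  have hadd := h.add_le
  obtain ⟨hσ, hmono⟩ := avoids132_insertPoint_zero_iff.1 h.avoids
  refine ⟨hσ, by omega, fun i hi => ?_, fun i hi => ?_, fun i => ?_⟩
  · by_contra hlt
    obtain ⟨t, ht⟩ := σ.surjective ⟨v, by omega⟩
    have hti : t < i := hmono t i (by rw [ht, Fin.le_def]; simp) (by
      rw [ht, Fin.lt_def]
      simp only
      omega)
    rw [Fin.lt_def] at hti
    omega
  · have := h.bottom_row (Fin.succAbove 0 i)
    rw [insertPoint_apply_succAbove, val_succAbove v, Fin.zero_succAbove, Fin.val_succ] at this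
    split_ifs at this <;> omega
  · have := h.corner (Fin.succAbove 0 i)
    rw [insertPoint_apply_succAbove, val_succAbove v, Fin.zero_succAbove, Fin.val_succ] at this
    split_ifs at this <;> omega

theorem corner132_insertPoint_iff {v : Fin (N + 1)} (hv : (v : ℕ) + a = N) {σ : Perm (Fin N)} :
    Corner132 (N + 1) (a + 1) b (insertPoint 0 v σ) ↔ Corner132 N a b σ := by
  refine ⟨Corner132.of_insertPoint hv, fun h => ?_⟩
  have hadd := h.add_le
  refine Corner132.of_succ (avoids132_insertPoint_zero_iff.2 ⟨h.avoids, fun i j hvi hij => ?_⟩)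
    (by rw [insertPoint_apply_self]; omega)
    (forall_fin_insertPoint_iff (p := fun i w => w = 0 → i + b ≤ N + 1).2
      ⟨by rw [Fin.val_zero]; omega, fun i hi => ?_⟩)
    (forall_fin_insertPoint_iff (p := fun i w => i + b < N + 1 ∨ w + (a + 1) < N + 1).2
      ⟨by rw [Fin.val_zero]; omega, fun i => ?_⟩)
  · rw [Fin.le_def, Fin.val_castSucc] at hvi
    exact h.avoids.lt_of_apply_lt h.first_column (by omega) hij
  · have := h.bottom_row i
    rw [val_succAbove v] at hi
    rw [Fin.zero_succAbove, Fin.val_succ]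
    split_ifs at hi
    omega
  · have := h.corner i
    rw [val_succAbove v, Fin.zero_succAbove, Fin.val_succ]
    split_ifs <;> omega

theorem corner132_succ_iff {v : Fin (N + 1)} (hv : (v : ℕ) + a = N) {σ : Perm (Fin (N + 1))} :
    Corner132 (N + 1) (a + 2) b σ ↔ Corner132 (N + 1) (a + 1) b σ ∧ σ 0 ≠ v := by
  constructor
  · intro h
    have hfirst := h.first_column 0 rfl
    refine ⟨Corner132.of_succ h.avoids (by omega) h.bottom_row fun i => ?_, fun heq => ?_⟩
    · have := h.corner i
      omega
    · rw [heq] at hfirst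
      omega
  · rintro ⟨h, hne⟩
    have hadd := h.add_le
    have hfirst := h.first_column 0 rfl
    have hne' : (σ 0 : ℕ) ≠ v := Fin.val_ne_of_ne hne
    refine Corner132.of_succ h.avoids (by omega) h.bottom_row fun i => ?_
    by_contra hi
    have hcorner := h.corner i
    obtain ⟨t, ht⟩ := σ.surjective (Fin.last N)
    have htop := h.corner t
    have ht0 : t ≠ 0 := by
      rintro rfl
      rw [ht, Fin.val_last] at hfirst
      rw [ht, Fin.val_last] at hne'
      omega
    rw [ht, Fin.val_last] at htop
    have hi0 : i ≠ 0 := by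
      rintro rfl
      rw [Fin.val_zero] at hi
      omega
    have h0i : σ 0 < σ i :=
      lt_of_le_of_ne (Fin.le_def.2 (by omega)) (σ.injective.ne hi0.symm)
    refine h.avoids 0 t i (Fin.pos_iff_ne_zero.2 ht0) (Fin.lt_def.2 (by omega)) h0i ?_
    rw [ht, Fin.lt_def, Fin.val_last]
    omega

theorem corner132_insertPoint_row_iff {c : Fin (N + 1)} (hc : (c : ℕ) + b = N)
    {σ : Perm (Fin N)} :
    Corner132 (N + 1) a (b + 1) (insertPoint c 0 σ) ↔ Corner132 N a b σ := by
  rw [← corner132_inverse_iff, insertPoint_inv, corner132_insertPoint_iff hc,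
    corner132_inverse_iff]

theorem corner132_succ_row_iff {c : Fin (N + 1)} (hc : (c : ℕ) + b = N)
    {σ : Perm (Fin (N + 1))} :
    Corner132 (N + 1) a (b + 2) σ ↔ Corner132 (N + 1) a (b + 1) σ ∧ σ c ≠ 0 := by
  rw [← corner132_inverse_iff, corner132_succ_iff hc, corner132_inverse_iff, ne_eq,
    Equiv.Perm.inv_eq_iff_eq, eq_comm]

theorem corner132_insertPoint_last_iff {σ : Perm (Fin N)} :
    Corner132 (N + 1) 0 (b + 1) (insertPoint (Fin.last N) (Fin.last N) σ) ↔
      Corner132 N 0 b σ := by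
  constructor
  · intro h
    have hadd := h.add_le
    refine ⟨avoids132_insertPoint_last_iff.1 h.avoids, by omega, fun i _ => by omega,
      fun i hi => ?_, fun i => Or.inr (by omega)⟩
    have := h.bottom_row (Fin.succAbove (Fin.last N) i)
    rw [insertPoint_apply_succAbove, Fin.succAbove_last, Fin.val_castSucc, Fin.val_castSucc] at this
    have := this hi
    omega
  · intro h
    have hadd := h.add_le
    refine Corner132.of_succ (avoids132_insertPoint_last_iff.2 h.avoids) (by omega)
      (forall_fin_insertPoint_iff (p := fun i w => w = 0 → i + (b + 1) ≤ N + 1).2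
        ⟨by rw [Fin.val_last]; omega, fun i => ?_⟩) fun i => Or.inr (by omega)
    have := h.bottom_row i
    rw [Fin.succAbove_last, Fin.val_castSucc, Fin.val_castSucc]
    omega

theorem corner132_succ_zero_iff {σ : Perm (Fin (N + 1))} :
    Corner132 (N + 1) 1 (b + 1) σ ↔
      Corner132 (N + 1) 0 (b + 1) σ ∧ σ (Fin.last N) ≠ Fin.last N := by
  constructor
  · intro h
    refine ⟨Corner132.of_succ h.avoids (by omega) h.bottom_row fun i => Or.inr (by omega),
      fun heq => ?_⟩
    have := h.corner (Fin.last N)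
    rw [heq, Fin.val_last] at this
    omega
  · rintro ⟨h, hne⟩
    refine Corner132.of_succ h.avoids (by omega) h.bottom_row fun i => ?_
    by_contra hi
    have hlast : i < Fin.last N := by
      refine lt_of_le_of_ne (Fin.le_last _) ?_
      rintro rfl
      exact hne (Fin.ext (by rw [Fin.val_last]; omega))
    have := h.inverse.avoids.lt_of_apply_lt h.inverse.first_column (i := σ i)
      (j := σ (Fin.last N)) (by simp only [Equiv.Perm.coe_inv, Equiv.symm_apply_apply]; omega)
      (by simpa using hlast)
    rw [Fin.lt_def] at this
    omega

theorem corner132_zero_one_iff {σ : Perm (Fin (N + 1))} :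
    Corner132 (N + 1) 0 1 σ ↔ Avoids132 σ :=
  ⟨Corner132.avoids, fun h => Corner132.of_succ h (by omega) (fun i _ => by omega)
    fun i => Or.inr (by omega)⟩

end Avoids132

section CornerSum132

variable {R : Type*} [CommSemiring R] (x y q : R)

/-- The weight of the point in column `j` and row `w` of the graph of a `132`-avoiding permutation
with respect to the diagonal shifted upwards by `s`, where `m` is the number of points to its lower
left. Points on that diagonal in columns `≥ c` do not get the factor `x`. -/
def weight132 (s : ℤ) (c j w m : ℕ) : R :=
  if j + s < w then y * q ^ min m (w - j - s - 1).toNat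
  else if j + s = w ∧ j < c then x else q ^ min m (j + s - w).toNat

/-- The weight sum of the permutations in `Corner132 N a b`. -/
noncomputable def cornerSum132 (N a b : ℕ) : R :=
  weightSum (Corner132 N a b) (weight132 x y q ((b - a) / 2) (N - b))

variable {s : ℤ} {c j w : ℕ}

theorem weight132_of_lt (d m : ℕ) (h : (w : ℤ) = j + s + 1 + d) :
    weight132 x y q s c j w m = y * q ^ min m d := by
  rw [weight132, if_pos (by omega), show (w - j - s - 1 : ℤ).toNat = d by omega]

theorem weight132_of_le (d m : ℕ) (h : (j : ℤ) + s = w + d) (hc : d = 0 → c ≤ j) :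
    weight132 x y q s c j w m = q ^ min m d := by
  rw [weight132, if_neg (by omega), if_neg (by omega), show (j + s - w : ℤ).toNat = d by omega]

theorem weight132_congr {s' : ℤ} {c' j' w' : ℕ} (m : ℕ) (h : (w : ℤ) - j - s = w' - j' - s')
    (hc : (j : ℤ) + s = w → (j < c ↔ j' < c')) :
    weight132 x y q s c j w m = weight132 x y q s' c' j' w' m := by
  have hlt : (j : ℤ) + s < w ↔ (j' : ℤ) + s' < w' := by omega
  have heq : (j : ℤ) + s = w ∧ j < c ↔ (j' : ℤ) + s' = w' ∧ j' < c' := by omega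
  rw [weight132, weight132, h, show (j : ℤ) + s - w = j' + s' - w' by omega]
  simp only [hlt, heq]

variable {N a b : ℕ}

theorem cornerSum132_eq_zero (h : N < a + b) : cornerSum132 x y q N a b = 0 :=
  weightSum_eq_zero (fun _ hσ => hσ.add_le.not_gt h) _

theorem cornerSum132_length_zero : cornerSum132 x y q 0 0 0 = 1 :=
  weightSum_of_length_zero (fun _ => corner132_zero_zero_iff.2 fun i => i.elim0) _

theorem cornerSum132_succ_zero_zero (N : ℕ) :
    cornerSum132 x y q (N + 1) 0 0 =
      cornerSum132 x y q (N + 1) 1 1 + x * cornerSum132 x y q N 0 0 := by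
  have hpeel := weightSum_eq_add (Fin.last N) (Fin.last N)
    (φ := weight132 x y q 0 (N + 1)) (z := x)
    (fun σ => corner132_succ_zero_iff (b := 0)) (fun σ => corner132_insertPoint_last_iff.symm)
    (fun σ => by simp [weight132])
  have hzero (σ : Perm (Fin (N + 1))) : Corner132 (N + 1) 0 0 σ ↔ Corner132 (N + 1) 0 1 σ := by
    rw [corner132_zero_zero_iff, corner132_zero_one_iff]
  simp only [cornerSum132]
  refine (weightSum_congr hzero fun _ _ _ => rfl).trans (hpeel.trans ?_)
  refine congrArg₂ _ ?_ (congrArg _ ?_)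
  · refine weightSum_congr (fun _ => Iff.rfl) fun σ hσ j => ?_
    refine weight132_congr x y q _ (by omega) fun h => ?_
    have := hσ.corner j
    omega
  · refine weightSum_congr (fun _ => Iff.rfl) fun σ _ j => ?_
    rw [Fin.val_last, shiftWeight_last j.isLt (σ j).isLt]
    exact weight132_congr x y q _ (by omega) (by omega)

theorem cornerSum132_peel_last_of_even (hb : Even b) :
    cornerSum132 x y q (N + 1) 0 (b + 1) =
      cornerSum132 x y q (N + 1) 1 (b + 1) + q ^ (b / 2) * cornerSum132 x y q N 0 b := by
  rcases lt_or_ge N b with hN | hN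
  · rw [cornerSum132_eq_zero x y q (by omega), cornerSum132_eq_zero x y q (by omega),
      cornerSum132_eq_zero x y q (by omega), mul_zero, add_zero]
  obtain ⟨h, rfl⟩ := hb
  have hpoint : weight132 x y q h (N - (h + h)) N N N = q ^ h := by
    rw [weight132_of_le x y q (j := N) (w := N) h N (by omega) (by omega),
      min_eq_right (by omega)]
  have hpeel := weightSum_eq_add (Fin.last N) (Fin.last N)
    (φ := weight132 x y q h (N - (h + h))) (z := q ^ h)
    (fun σ => corner132_succ_zero_iff (b := h + h)) (fun σ => corner132_insertPoint_last_iff.symm)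
    (fun σ => by rw [lowerLeft_insertPoint_last]; exact hpoint)
  simp only [cornerSum132, show N + 1 - (h + h + 1) = N - (h + h) by omega,
    show (((h + h + 1 : ℕ) : ℤ) - (0 : ℕ)) / 2 = h by omega,
    show (((h + h + 1 : ℕ) : ℤ) - (1 : ℕ)) / 2 = h by omega,
    show (((h + h : ℕ) : ℤ) - (0 : ℕ)) / 2 = h by omega, show (h + h) / 2 = h by omega]
  refine hpeel.trans (congrArg _ (congrArg _ ?_))
  refine weightSum_congr (fun _ => Iff.rfl) fun σ _ j => ?_
  rw [Fin.val_last, shiftWeight_last j.isLt (σ j).isLt]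

theorem cornerSum132_peel_last_of_odd (ha : Odd a) :
    cornerSum132 x y q (N + 1) (a + 1) 0 =
      cornerSum132 x y q (N + 1) (a + 1) 1 + y * q ^ (a / 2) * cornerSum132 x y q N a 0 := by
  rcases lt_or_ge N a with hN | hN
  · rw [cornerSum132_eq_zero x y q (by omega), cornerSum132_eq_zero x y q (by omega),
      cornerSum132_eq_zero x y q (by omega), mul_zero, add_zero]
  obtain ⟨h, rfl⟩ := ha
  have hpoint : weight132 x y q (-(h + 1)) (N + 1) N N N = y * q ^ h := by
    rw [weight132_of_lt x y q (j := N) (w := N) h N (by omega), min_eq_right (by omega)]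
  have hpeel := weightSum_eq_add (Fin.last N) (Fin.last N)
    (φ := weight132 x y q (-(h + 1)) (N + 1)) (z := y * q ^ h)
    (P := Corner132 (N + 1) (2 * h + 2) 0) (P₁ := Corner132 (N + 1) (2 * h + 2) 1)
    (P₀ := Corner132 N (2 * h + 1) 0)
    (fun σ => by
      rw [← corner132_inverse_iff, corner132_succ_zero_iff, corner132_inverse_iff, ne_eq,
        Equiv.Perm.inv_eq_iff_eq, eq_comm])
    (fun σ => by
      rw [← corner132_inverse_iff, ← corner132_insertPoint_last_iff, ← insertPoint_inv,
        corner132_inverse_iff])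
    (fun σ => by rw [lowerLeft_insertPoint_last]; exact hpoint)
  simp only [cornerSum132, Nat.sub_zero, Nat.add_sub_cancel,
    show (((0 : ℕ) : ℤ) - (2 * h + 1 + 1 : ℕ)) / 2 = -(h + 1) by omega,
    show (((1 : ℕ) : ℤ) - (2 * h + 1 + 1 : ℕ)) / 2 = -(h + 1) by omega,
    show (((0 : ℕ) : ℤ) - (2 * h + 1 : ℕ)) / 2 = -(h + 1) by omega,
    show (2 * h + 1) / 2 = h by omega]
  refine hpeel.trans (congrArg₂ _ ?_ (congrArg _ ?_))
  · refine weightSum_congr (fun _ => Iff.rfl) fun σ hσ j => ?_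
    refine weight132_congr x y q _ rfl fun h => ?_
    have := hσ.row_bound (j := j)
    omega
  · refine weightSum_congr (fun _ => Iff.rfl) fun σ _ j => ?_
    rw [Fin.val_last, shiftWeight_last j.isLt (σ j).isLt]
    exact weight132_congr x y q _ rfl (by omega)

theorem cornerSum132_peel_first (hab : Even (a + b)) :
    cornerSum132 x y q (N + 1) (a + 1) b =
      cornerSum132 x y q (N + 1) (a + 2) b + y * q ^ a * cornerSum132 x y q N a b := by
  rcases lt_or_ge N (a + b) with hN | hN
  · rw [cornerSum132_eq_zero x y q hN, cornerSum132_eq_zero x y q (by omega),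
      cornerSum132_eq_zero x y q (by omega), mul_zero, add_zero]
  obtain ⟨h, hh⟩ := hab
  obtain ⟨v, hv⟩ : ∃ v : Fin (N + 1), (v : ℕ) + a = N :=
    ⟨⟨N - a, by omega⟩, Nat.sub_add_cancel (by omega)⟩
  have hpoint : weight132 x y q (h - a - 1) (N + 1 - b) 0 v 0 = y :=
    (weight132_of_lt x y q (j := 0) (N - h) 0 (by omega)).trans (by simp)
  have hpeel := weightSum_eq_add 0 v
    (φ := weight132 x y q (h - a - 1) (N + 1 - b)) (z := y)
    (fun σ => corner132_succ_iff (b := b) hv)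
    (fun σ => (corner132_insertPoint_iff hv).symm)
    (fun σ => by rw [lowerLeft_insertPoint_zero]; exact hpoint)
  simp only [cornerSum132, show ((b : ℤ) - (a + 2 : ℕ)) / 2 = h - a - 1 by omega,
    show ((b : ℤ) - (a + 1 : ℕ)) / 2 = h - a - 1 by omega,
    show ((b : ℤ) - a) / 2 = h - a by omega]
  rw [hpeel, mul_assoc]
  congr 2
  refine weightSum_eq_pow_mul_of_top_rows (by omega) q fun σ hσ j => ?_
  have hpos := hσ.position_bound (j := j)
  simp only [shiftWeight, Fin.val_zero, Nat.not_lt_zero, if_false, Nat.zero_le, true_and]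
  by_cases hw : (σ j : ℕ) < v
  · rw [if_pos hw, if_neg (by omega), if_neg (by omega), one_mul]
    exact weight132_congr x y q _ (by omega) (by omega)
  · obtain ⟨d, hd⟩ : ∃ d : ℕ, (σ j : ℤ) = j + (h - a) + 1 + d :=
      ⟨(σ j - j - (h - a) - 1 : ℤ).toNat, by omega⟩
    rw [if_neg hw, if_pos (by omega), if_pos (by omega), weight132_of_lt x y q (d + 1) _ (by omega),
      weight132_of_lt x y q d _ hd, min_add_add_right, pow_succ]
    ring

theorem cornerSum132_peel_bottom (hab : Odd (a + b)) :
    cornerSum132 x y q (N + 1) a (b + 1) =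
      cornerSum132 x y q (N + 1) a (b + 2) + q ^ b * cornerSum132 x y q N a b := by
  rcases lt_or_ge N (a + b) with hN | hN
  · rw [cornerSum132_eq_zero x y q hN, cornerSum132_eq_zero x y q (by omega),
      cornerSum132_eq_zero x y q (by omega), mul_zero, add_zero]
  obtain ⟨h, hh⟩ := hab
  obtain ⟨c, hc⟩ : ∃ c : Fin (N + 1), (c : ℕ) + b = N :=
    ⟨⟨N - b, by omega⟩, Nat.sub_add_cancel (by omega)⟩
  have hpoint : weight132 x y q (h - a + 1) (N - b) c 0 0 = 1 :=
    (weight132_of_le x y q (w := 0) (N + h + 1 - (a + b)) 0 (by omega)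
      (by omega)).trans (by simp)
  have hpeel := weightSum_eq_add c 0
    (φ := weight132 x y q (h - a + 1) (N - b)) (z := 1)
    (fun σ => corner132_succ_row_iff (a := a) hc)
    (fun σ => (corner132_insertPoint_row_iff hc).symm)
    (fun σ => (congrArg _ (by simp [lowerLeft])).trans hpoint)
  simp only [cornerSum132, show N + 1 - (b + 1) = N - b by omega,
    show N + 1 - (b + 2) = N - b - 1 by omega,
    show (((b + 2 : ℕ) : ℤ) - a) / 2 = h - a + 1 by omega,
    show (((b + 1 : ℕ) : ℤ) - a) / 2 = h - a + 1 by omega,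
    show ((b : ℤ) - a) / 2 = h - a by omega]
  rw [hpeel, one_mul]
  refine congrArg₂ _ ?_ ?_
  · refine weightSum_congr (fun _ => Iff.rfl) fun σ hσ j => ?_
    refine weight132_congr x y q _ rfl fun h => ?_
    have := hσ.row_bound (j := j)
    omega
  refine weightSum_eq_pow_mul_of_last_columns (by omega) q fun σ hσ j => ?_
  have hrow := hσ.row_bound (j := j)
  simp only [shiftWeight, Fin.val_zero, Nat.not_lt_zero, if_false, Nat.zero_le, and_true]
  by_cases hj : (j : ℕ) < c
  · rw [if_pos hj, if_neg (by omega), if_neg (by omega), one_mul]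
    exact weight132_congr x y q _ (by push_cast; omega) (by omega)
  · obtain ⟨d, hd⟩ : ∃ d : ℕ, (j : ℤ) + (h - a) = σ j + d :=
      ⟨(j + (h - a) - σ j : ℤ).toNat, by omega⟩
    rw [if_neg hj, if_pos (by omega), if_pos (by omega),
      weight132_of_le x y q (d + 1) _ (by push_cast; omega) (by omega),
      weight132_of_le x y q d _ hd (by omega), min_add_add_right, pow_succ]
    ring

end CornerSum132

section CornerSum132

/-- The exponent of `q` in the closed form of `cornerSum132`. Its growth in either argument depends
on the parity of the sum of the arguments. -/
def cornerExponent : ℕ → ℕ → ℕ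
  | 0, 0 => 0
  | 0, b + 1 => cornerExponent 0 b + if Even b then b / 2 else b
  | a + 1, b => cornerExponent a b + if Even (a + b) then a else (a + b) / 2

variable {a b h : ℕ}

theorem cornerExponent_succ_left_of_even (hab : a + b = 2 * h) :
    cornerExponent (a + 1) b = cornerExponent a b + a := by
  rw [cornerExponent, if_pos (by grind)]

theorem cornerExponent_succ_left_of_odd (hab : a + b = 2 * h + 1) :
    cornerExponent (a + 1) b = cornerExponent a b + h := by
  rw [cornerExponent, if_neg (by grind)]
  omega

theorem cornerExponent_succ_right (a b : ℕ) :
    cornerExponent a (b + 1) =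
      cornerExponent a b + if Even (a + b) then (a + b) / 2 else b := by
  induction a with
  | zero => simp [cornerExponent]
  | succ a ih =>
    rw [cornerExponent, cornerExponent, ih]
    rcases Nat.even_or_odd' (a + b) with ⟨h, hab | hab⟩
    · rw [if_pos (by grind), if_neg (by grind), if_pos (by grind), if_neg (by grind)]
      omega
    · rw [if_neg (by grind), if_pos (by grind), if_neg (by grind), if_pos (by grind)]
      omega

theorem cornerExponent_succ_right_of_even (hab : a + b = 2 * h) :
    cornerExponent a (b + 1) = cornerExponent a b + h := by
  rw [cornerExponent_succ_right, if_pos (by grind)]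
  omega

theorem cornerExponent_succ_right_of_odd (hab : a + b = 2 * h + 1) :
    cornerExponent a (b + 1) = cornerExponent a b + b := by
  rw [cornerExponent_succ_right, if_neg (by grind)]

variable {R : Type*} [CommSemiring R] (x y q : R)

theorem cornerSum132_succ_of_forall {t : ℕ}
    (ht : ∀ h a b, a + b = 2 * h → cornerSum132 x y q (t + h) a b =
      y ^ a * q ^ cornerExponent a b * motzkinSum x y q t h) (hab : a + b = 2 * h + 1) :
    cornerSum132 x y q (t + h + 1) a b =
      y ^ a * q ^ cornerExponent a b * motzkinHalfSum x y q t h := by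
  have hnext : cornerSum132 x y q (t + h + 1) (a + 1) b =
      y ^ (a + 1) * q ^ cornerExponent (a + 1) b * motzkinSum x y q t (h + 1) :=
    ht (h + 1) (a + 1) b (by omega)
  rw [cornerExponent_succ_left_of_odd hab] at hnext
  rw [motzkinHalfSum]
  cases a with
  | zero =>
    obtain rfl : b = 2 * h + 1 := by omega
    rw [cornerSum132_peel_last_of_even x y q (even_two_mul h), hnext, ht h 0 (2 * h) (by omega),
      cornerExponent_succ_right_of_even (h := h) (by omega), Nat.mul_div_cancel_left h two_pos]
    ring
  | succ a =>
    rw [cornerSum132_peel_first x y q (by grind), hnext, ht h a b (by omega),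
      cornerExponent_succ_left_of_even (h := h) (by omega)]
    ring

theorem cornerSum132_eq (t : ℕ) : ∀ h a b, a + b = 2 * h → cornerSum132 x y q (t + h) a b =
    y ^ a * q ^ cornerExponent a b * motzkinSum x y q t h := by
  induction t with
  | zero =>
    rintro (_ | h) a b hab
    · obtain ⟨rfl, rfl⟩ : a = 0 ∧ b = 0 := by omega
      simp [cornerSum132_length_zero, cornerExponent, motzkinSum]
    · rw [cornerSum132_eq_zero x y q (by omega), motzkinSum, mul_zero]
  | succ t ih =>
    have hodd {h a b : ℕ} (hab : a + b = 2 * h + 1) :=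
      cornerSum132_succ_of_forall x y q ih hab
    rintro (_ | h) a b hab
    · obtain ⟨rfl, rfl⟩ : a = 0 ∧ b = 0 := by omega
      have h0 : cornerSum132 x y q t 0 0 = motzkinSum x y q t 0 := by
        simpa [cornerExponent] using ih 0 0 0 rfl
      have h1 : cornerSum132 x y q (t + 1) 1 1 = y * motzkinSum x y q t 1 := by
        simpa [cornerExponent] using ih 1 1 1 rfl
      rw [add_zero, cornerSum132_succ_zero_zero, h0, h1, motzkinSum, cornerExponent]
      ring
    · have hnext := hodd (h := h + 1) (a := a) (b := b + 1) (by omega)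
      rw [cornerExponent_succ_right_of_even hab, ← add_assoc t] at hnext
      rw [motzkinSum_succ_succ, show t + 1 + (h + 1) = t + h + 1 + 1 by ring]
      cases b with
      | zero =>
        obtain rfl : a = 2 * h + 1 + 1 := by omega
        rw [cornerSum132_peel_last_of_odd x y q (odd_two_mul_add_one h), hnext,
          hodd (h := h) (by omega), cornerExponent_succ_left_of_odd (h := h) (by omega),
          show (2 * h + 1) / 2 = h by omega]
        ring
      | succ b =>
        rw [cornerSum132_peel_bottom x y q (by grind), hnext, hodd (h := h) (by omega),
          cornerExponent_succ_right_of_odd (h := h) (by omega)]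
        ring

end CornerSum132

section Crossings

theorem card_filter_le_of_upward_closed {A : Finset ℕ} {n : ℕ} (hA : ∀ a ∈ A, a < n)
    (hup : ∀ a ∈ A, ∀ b, a ≤ b → b < n → b ∈ A) (k : ℕ) :
    #{a ∈ A | k ≤ a} = min #A (n - k) := by
  by_cases h : ∃ a ∈ A, a < k
  · obtain ⟨a, ha, hak⟩ := h
    have hIco : {a ∈ A | k ≤ a} = Ico k n := by
      ext b
      rw [mem_filter, mem_Ico]
      exact ⟨fun hb => ⟨hb.2, hA b hb.1⟩, fun hb => ⟨hup a ha b (by omega) hb.2, hb.1⟩⟩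
    have hle := card_filter_le A (k ≤ ·)
    rw [hIco, Nat.card_Ico] at *
    exact (min_eq_right hle).symm
  · push Not at h
    have hle : #A ≤ #(Ico k n) := card_le_card fun a ha => mem_Ico.2 ⟨h a ha, hA a ha⟩
    rw [Nat.card_Ico] at hle
    rw [filter_true_of_mem h, min_eq_left hle]

variable {n : ℕ} {σ : Perm (Fin n)}

/-- In a `132`-avoiding permutation, the columns of the points to the lower left of a point are
upward closed among the columns to the left of this point. -/
theorem Avoids132.card_lowerLeft_column_ge (hσ : Avoids132 σ) (j : Fin n) (k : ℕ) :
    #{i : Fin n | (i < j ∧ σ i < σ j) ∧ k ≤ (i : ℕ)} = min (lowerLeft σ j) (j - k) := by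
  have h := card_filter_le_of_upward_closed (n := j)
    (A := ({i : Fin n | i < j ∧ σ i < σ j} : Finset (Fin n)).map Fin.valEmbedding)
    (fun a ha => ?_) (fun a ha b hab hb => ?_) k
  · rwa [filter_map, card_map, card_map, filter_filter] at h
  · obtain ⟨i, hi, rfl⟩ := mem_map.1 ha
    exact ((mem_filter_univ _).1 hi).1
  obtain ⟨i, hi, rfl⟩ := mem_map.1 ha
  obtain ⟨-, hij⟩ : i < j ∧ σ i < σ j := by simpa using hi
  refine mem_map.2 ⟨⟨b, hb.trans j.isLt⟩, (mem_filter_univ _).2 ⟨hb, ?_⟩, rfl⟩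
  rcases eq_or_lt_of_le hab with rfl | hib
  · exact hij
  · refine lt_of_le_of_ne (not_lt.1 (hσ i ⟨b, _⟩ j hib hb hij)) fun h => ?_
    exact hb.ne (congrArg Fin.val (σ.injective h))

theorem Avoids132.card_lowerLeft_row_ge (hσ : Avoids132 σ) (j : Fin n) (k : ℕ) :
    #{i : Fin n | (i < j ∧ σ i < σ j) ∧ k ≤ (σ i : ℕ)} = min (lowerLeft σ j) (σ j - k) := by
  rw [← lowerLeft_inverse, ← hσ.inverse.card_lowerLeft_column_ge]
  refine card_equiv σ fun i => ?_
  simp [and_comm]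

theorem Avoids132.crs_eq (hσ : Avoids132 σ) :
    crs n σ = ∑ j, if j < σ j then min (lowerLeft σ j) (σ j - j - 1)
      else min (lowerLeft σ j) (j - σ j) := by
  rw [crs, card_filter, Fintype.sum_prod_type_right]
  refine sum_congr rfl fun j _ => ?_
  rw [← card_filter]
  split_ifs with h
  · rw [Nat.sub_sub, ← hσ.card_lowerLeft_row_ge]
    congr 1 with i
    grind
  · rw [← hσ.card_lowerLeft_column_ge]
    congr 1 with i
    grind

theorem crs_eq_add :
    crs n σ = ∑ j, (#{i | i < j ∧ j < σ i ∧ σ i < σ j} + #{l | σ j < σ l ∧ σ l ≤ j ∧ j < l}) := by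
  rw [crs, filter_or, card_union_of_disjoint (disjoint_filter.2 (by grind)), sum_add_distrib,
    card_pairs_eq_sum fun i j => σ i < σ j ∧ σ j ≤ i ∧ i < j, card_filter,
    Fintype.sum_prod_type_right]
  simp only [card_filter]

/-- As many arcs `i ↦ σ i` lead over `j` to the right as to the left. If `σ j < j`, the ones to the
left are those that cross the arc at `j`; if `j < σ j`, the ones to the right are. -/
theorem Avoids321.card_lt_lt_apply (hσ : Avoids321 σ) (j : Fin n) :
    #{i | i < j ∧ j < σ i} =
      #{i | i < j ∧ j < σ i ∧ σ i < σ j} + #{l | σ j < σ l ∧ σ l ≤ j ∧ j < l} := by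
  rcases lt_trichotomy (σ j) j with hj | hj | hj
  · have hlt {l : Fin n} (hlj : σ l ≤ j) (hjl : j < l) : σ j < σ l := by
      obtain ⟨i, hij, hji⟩ := (exists_le_lt_apply_iff σ j).2 ⟨l, hjl, hlj⟩
      have hne : i ≠ j := by
        rintro rfl
        exact hj.not_gt hji
      refine lt_of_le_of_ne (not_lt.1 (hσ i j l (lt_of_le_of_ne hij hne) hjl (hj.trans hji))) ?_
      exact fun h => hjl.ne (σ.injective h)
    rw [filter_false_of_mem (p := fun i => i < j ∧ j < σ i ∧ σ i < σ j) (by grind), card_empty,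
      zero_add]
    calc #{i | i < j ∧ j < σ i} = #{i | i ≤ j ∧ j < σ i} := by congr 1 with i; grind
      _ = #{l | j < l ∧ σ l ≤ j} := card_le_lt_eq_card_lt_le σ j
      _ = #{l | σ j < σ l ∧ σ l ≤ j ∧ j < l} := by congr 1 with l; grind
  · have hne := fun i hij hji => hσ.apply_ne (i := i) hij hji hj
    rw [filter_false_of_mem (by grind), filter_false_of_mem (by grind),
      filter_false_of_mem (by grind)]
    rfl
  · have hlt {i : Fin n} (hij : i < j) (hji : j < σ i) : σ i < σ j := by
      obtain ⟨l, hjl, hlj⟩ := (exists_le_lt_apply_iff σ j).1 ⟨i, hij.le, hji⟩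
      refine lt_of_le_of_ne (not_lt.1 fun h => hσ i j l hij hjl h (hlj.trans_lt hj)) ?_
      exact fun h => hij.ne (σ.injective h)
    rw [filter_false_of_mem (p := fun l => σ j < σ l ∧ σ l ≤ j ∧ j < l) (by grind), card_empty,
      add_zero]
    congr 1 with i
    grind

theorem Avoids321.crs_eq (hσ : Avoids321 σ) : crs n σ = ∑ i, ((σ i : ℕ) - i - 1) := by
  simp only [crs_eq_add, ← hσ.card_lt_lt_apply]
  simp only [card_filter]
  rw [sum_comm]
  refine sum_congr rfl fun i _ => ?_
  rw [← card_filter, ← Fin.card_Ioo]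
  congr 1 with j
  simp

end Crossings

section GeneratingPolynomial

variable {n : ℕ} {σ : Perm (Fin n)} {R : Type*} [CommSemiring R] (x y q : R)

theorem prod_mul_pow_eq (c : Fin n → ℕ) :
    ∏ i, ((if σ i = i then x else 1) * (if i < σ i then y else 1) * q ^ c i) =
      x ^ fp n σ * y ^ exc n σ * q ^ ∑ i, c i := by
  rw [prod_mul_distrib, prod_mul_distrib, prod_ite, prod_ite, prod_pow_eq_pow_sum]
  simp [fp, exc]

theorem Avoids321.prod_weight321 (hσ : Avoids321 σ) :
    ∏ j : Fin n, weight321 x y q n j (σ j) (lowerLeft σ j) =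
      x ^ fp n σ * y ^ exc n σ * q ^ crs n σ := by
  rw [hσ.crs_eq, ← prod_mul_pow_eq]
  refine prod_congr rfl fun j _ => ?_
  simp only [weight321, Fin.lt_def, Fin.ext_iff]
  rcases lt_trichotomy (j : ℕ) (σ j) with h | h | h
  · simp [h, h.ne']
  · simp [← h, j.isLt]
  · simp [h.not_gt, h.ne, h.ne', Nat.sub_eq_zero_of_le h.le]

theorem Avoids132.prod_weight132 (hσ : Avoids132 σ) :
    ∏ j : Fin n, weight132 x y q 0 n j (σ j) (lowerLeft σ j) =
      x ^ fp n σ * y ^ exc n σ * q ^ crs n σ := by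
  rw [hσ.crs_eq, ← prod_mul_pow_eq]
  refine prod_congr rfl fun j _ => ?_
  simp only [Fin.lt_def, Fin.ext_iff]
  rcases lt_trichotomy (j : ℕ) (σ j) with h | h | h
  · rw [weight132_of_lt x y q (σ j - j - 1) _ (by omega)]
    simp [h, h.ne']
  · simp [weight132, ← h]
  · rw [weight132_of_le x y q (j - σ j) _ (by omega) (by omega)]
    simp [h.not_gt, h.ne]

variable {P : Perm (Fin n) → Prop} {φ : ℕ → ℕ → ℕ → MvPolynomial (Fin 3) ℤ}

theorem genPoly_eq_weightSum {k : ℕ} {τ : Perm (Fin k)} (hP : ∀ σ, ¬ Contains σ τ ↔ P σ)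
    (hφ : ∀ σ, P σ → ∏ j : Fin n, φ j (σ j) (lowerLeft σ j) =
      MvPolynomial.X 0 ^ fp n σ * MvPolynomial.X 1 ^ exc n σ * MvPolynomial.X 2 ^ crs n σ) :
    genPoly ![fp, exc, crs] {⟨k, τ⟩} n = weightSum P φ := by
  classical
  rw [genPoly, weightSum]
  refine sum_congr ?_ fun σ hσ => ?_
  · ext σ
    rw [mem_avoiders_singleton, hP, mem_filter_univ]
  · rw [hφ σ (mem_filter.1 hσ).2, Fin.prod_univ_three]
    rfl

theorem genPoly_p321 (n : ℕ) : genPoly ![fp, exc, crs] {⟨3, p321⟩} n =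
    motzkinSum (MvPolynomial.X 0) (MvPolynomial.X 1) (MvPolynomial.X 2) n 0 := by
  rw [genPoly_eq_weightSum (fun σ => not_contains_p321_iff.trans corner321_zero_iff.symm)
    fun σ hσ => Avoids321.prod_weight321 _ _ _ hσ.avoids]
  simpa [cornerSum321] using cornerSum321_eq (MvPolynomial.X 0 : MvPolynomial (Fin 3) ℤ)
    (MvPolynomial.X 1) (MvPolynomial.X 2) n 0

theorem genPoly_p132 (n : ℕ) : genPoly ![fp, exc, crs] {⟨3, p132⟩} n =
    motzkinSum (MvPolynomial.X 0) (MvPolynomial.X 1) (MvPolynomial.X 2) n 0 := by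
  rw [genPoly_eq_weightSum (fun σ => not_contains_p132_iff.trans corner132_zero_zero_iff.symm)
    fun σ hσ => Avoids132.prod_weight132 _ _ _ hσ.avoids]
  simpa [cornerSum132, cornerExponent] using
    cornerSum132_eq (MvPolynomial.X 0 : MvPolynomial (Fin 3) ℤ) (MvPolynomial.X 1)
      (MvPolynomial.X 2) n 0 0 0 rfl

end GeneratingPolynomial

section Classification

theorem wilfEquiv_p132_p321 : WilfEquiv ![fp, exc, crs] {⟨3, p132⟩} {⟨3, p321⟩} := fun n => by
  rw [genPoly_p132, genPoly_p321]

theorem wilfEquiv_p132_p213 {ι : Type*} [Fintype ι] {st : ι → Stat}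
    (hst : ∀ i n σ, st i n (antiTranspose σ) = st i n σ) :
    WilfEquiv st {⟨3, p132⟩} {⟨3, p213⟩} := by
  have hp213 : p213 = antiTranspose p132 := by decide
  rw [hp213]
  exact WilfEquiv.of_equiv
    (fun _ => Function.Involutive.toPerm antiTranspose antiTranspose_antiTranspose)
    (fun _ _ => contains_antiTranspose_iff) hst

theorem wilfEquiv_p231_p312 : WilfEquiv ![fp, inv, nes] {⟨3, p231⟩} {⟨3, p312⟩} := by
  have hp312 : p312 = p231⁻¹ := by decide
  rw [hp312]
  refine WilfEquiv.of_equiv (fun _ => Equiv.inv _) (fun _ _ => contains_inverse_iff)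
    fun i n σ => ?_
  fin_cases i
  exacts [fp_inverse σ, inv_inverse σ, nes_inverse σ]

theorem wilfClass_fp_exc_inv_crs_nes_p132 :
    wilfClass ![fp, exc, inv, crs, nes] p132 = {p132, p213} := by
  refine wilfClass_eq ?_ (by decide +kernel)
  rintro _ (rfl | rfl)
  · exact WilfEquiv.refl _
  · refine wilfEquiv_p132_p213 fun i n σ => ?_
    fin_cases i
    exacts [fp_antiTranspose σ, exc_antiTranspose σ, inv_antiTranspose σ, crs_antiTranspose σ,
      nes_antiTranspose σ]

theorem wilfClass_fp_inv_nes_p132 : wilfClass ![fp, inv, nes] p132 = {p132, p213} := by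
  refine wilfClass_eq ?_ (by decide +kernel)
  rintro _ (rfl | rfl)
  · exact WilfEquiv.refl _
  · refine wilfEquiv_p132_p213 fun i n σ => ?_
    fin_cases i
    exacts [fp_antiTranspose σ, inv_antiTranspose σ, nes_antiTranspose σ]

theorem wilfClass_fp_inv_nes_p231 : wilfClass ![fp, inv, nes] p231 = {p231, p312} := by
  refine wilfClass_eq ?_ (by decide +kernel)
  rintro _ (rfl | rfl)
  · exact WilfEquiv.refl _
  · exact wilfEquiv_p231_p312

theorem wilfClass_fp_exc_crs_p132 : wilfClass ![fp, exc, crs] p132 = {p132, p213, p321} := by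
  refine wilfClass_eq ?_ (by decide +kernel)
  rintro _ (rfl | rfl | rfl)
  · exact WilfEquiv.refl _
  · refine wilfEquiv_p132_p213 fun i n σ => ?_
    fin_cases i
    exacts [fp_antiTranspose σ, exc_antiTranspose σ, crs_antiTranspose σ]
  · exact wilfEquiv_p132_p321

theorem p132_ne_p213 : p132 ≠ p213 := by decide

theorem nonSingletonClasses_fp_exc_inv_crs_nes :
    nonSingletonClasses ![fp, exc, inv, crs, nes] 3 = {{p132, p213}} := by
  refine nonSingletonClasses_eq ?_ ?_
  · rintro _ rfl
    exact ⟨Set.nontrivial_pair p132_ne_p213, _, wilfClass_fp_exc_inv_crs_nes_p132.symm⟩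
  · simp only [Set.mem_singleton_iff, exists_eq_left]
    decide +kernel

theorem nonSingletonClasses_fp_inv_nes :
    nonSingletonClasses ![fp, inv, nes] 3 = {{p132, p213}, {p231, p312}} := by
  refine nonSingletonClasses_eq ?_ ?_
  · rintro _ (rfl | rfl)
    · exact ⟨Set.nontrivial_pair p132_ne_p213, _, wilfClass_fp_inv_nes_p132.symm⟩
    · exact ⟨Set.nontrivial_pair (by decide), _, wilfClass_fp_inv_nes_p231.symm⟩
  · simp only [Set.mem_insert_iff, Set.mem_singleton_iff, exists_eq_or_imp, exists_eq_left]
    decide +kernel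

theorem nonSingletonClasses_fp_exc_crs :
    nonSingletonClasses ![fp, exc, crs] 3 = {{p132, p213, p321}} := by
  refine nonSingletonClasses_eq ?_ ?_
  · rintro _ rfl
    exact ⟨⟨p132, by simp, p213, by simp, p132_ne_p213⟩, _, wilfClass_fp_exc_crs_p132.symm⟩
  · simp only [Set.mem_singleton_iff, exists_eq_left]
    decide +kernel

end Classification

end PermPattern

theorem mainTheorem7 :
    PermPattern.wilfClass
        ![PermPattern.fp, PermPattern.exc, PermPattern.inv, PermPattern.crs, PermPattern.nes]
        PermPattern.p132 = {PermPattern.p132, PermPattern.p213} ∧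
    PermPattern.wilfClass ![PermPattern.fp, PermPattern.inv, PermPattern.nes]
        PermPattern.p231 = {PermPattern.p231, PermPattern.p312} ∧
    PermPattern.wilfClass ![PermPattern.fp, PermPattern.exc, PermPattern.crs]
        PermPattern.p132 = {PermPattern.p132, PermPattern.p213, PermPattern.p321} ∧
    PermPattern.nonSingletonClasses
        ![PermPattern.fp, PermPattern.exc, PermPattern.inv, PermPattern.crs, PermPattern.nes] 3 =
      {{PermPattern.p132, PermPattern.p213}} ∧
    PermPattern.nonSingletonClasses ![PermPattern.fp, PermPattern.inv, PermPattern.nes] 3 =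
      {{PermPattern.p132, PermPattern.p213}, {PermPattern.p231, PermPattern.p312}} ∧
    PermPattern.nonSingletonClasses ![PermPattern.fp, PermPattern.exc, PermPattern.crs] 3 =
      {{PermPattern.p132, PermPattern.p213, PermPattern.p321}} :=
  open PermPattern in
  ⟨wilfClass_fp_exc_inv_crs_nes_p132, wilfClass_fp_inv_nes_p231, wilfClass_fp_exc_crs_p132,
    nonSingletonClasses_fp_exc_inv_crs_nes, nonSingletonClasses_fp_inv_nes,
    nonSingletonClasses_fp_exc_crs⟩
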